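/- **Model.** Consider a $K$-tier heterogeneous cellular network in $\mathbb{R}^2$ with path-loss exponent $\alpha>2$ and $\delta=2/\alpha$. Tier $j\in\{1,\dots,K\}$ has base-station (BS) density $\lambda_j>0$, transmit power $P_j>0$, $M_j\ge 2$ antennas and power allocation ratio $\phi_j\in(0,1]$; users and eavesdroppers have densities $\lambda_u,\lambda_e>0$; the access threshold is $\tau>0$. The BSs of the tiers ($\Phi_j$), the users ($\Phi_u$) and the eavesdroppers ($\Phi_e$) are independent homogeneous Poisson processes with these densities. At distance $r$ from a tier-$j$ BS the truncated received power is $P_jM_jr^{-\alpha}$ if $r\le D_j=(P_jM_j/\tau)^{1/\alpha}$ and $0$ otherwise; a user is associated with the BS providing the largest truncated received power, if this is positive. Let $\mathcal A_j$ be the BS activation probability of tier $j$, i.e. the probability that the typical tier-$j$ BS (placed at the origin and added to the BS processes) has at least one associated user, or alternatively the closed-form value used for it, $1-\exp\!\big(-\lambda_u(P_jM_j)^\delta\,\Xi^{-1}(1-e^{-\pi\tau^{-\delta}\Xi})\big)$ with $\Xi=\sum_i\lambda_i(P_iM_i)^\delta$ (the result holds for both). The active BSs of tier $j$ form an independent thinning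 $\Phi_j^o$ of $\Phi_j$ with retention probability $\mathcal A_j$. A serving BS $b$ of tier $k$ is located at a fixed point, in addition to the BSs of $\Phi_1,\dots,\Phi_K$. The channel from a BS $z$ of tier $j$ to an eavesdropper $e$ is $\mathbf h_{ze}r_{ze}^{-\alpha/2}$, where $r_{ze}$ is their distance and $\mathbf h_{ze}\in\mathbb C^{M_j}$ has i.i.d. $\mathcal{CN}(0,1)$ entries. Each BS $z$ uses the beamforming vector $\mathbf w_z=\overline{\mathbf h_z}/\|\mathbf h_z\|$, with $\mathbf h_z$ the ($\mathcal{CN}(0,1)$, i.i.d.) channel vector of its served user, and an artificial-noise matrix $\mathbf W_z\in\mathbb C^{M_j\times(M_j-1)}$ such that $[\mathbf w_z\ \mathbf W_z]$ is unitary. All locations, thinnings, fading vectors to eavesdroppers and pairs $(\mathbf h_z,\mathbf W_z)$ are independent. Eavesdroppers see interference from artificial noise only; in the interference-limited case (thermal noise $N_0=0$), $$\mathbf{SINR}_{e,k}=\frac{\phi_kP_k|\mathbf h_{be}^{\mathrm T}\mathbf w_b|^2r_{be}^{-\alpha}}{\dfrac{(1-\phi_k)P_k\|\mathbf h_{be}^{\mathrm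 T}\mathbf W_b\|^2}{(M_k-1)\,r_{be}^{\alpha}}+\displaystyle\sum_{j=1}^K\sum_{z\in\Phi_j^o}\frac{(1-\phi_j)P_j\|\mathbf h_{ze}^{\mathrm T}\mathbf W_z\|^2}{(M_j-1)\,r_{ze}^{\alpha}}},\qquad e\in\Phi_e .$$ For $\beta_e>0$ the secrecy probability of tier $k$ is $$\mathcal P^{int}_{s,k}=\mathbb E_{\Phi_1,\dots,\Phi_K,\Phi_e}\Big[\prod_{e\in\Phi_e}\mathbb P\{\mathbf{SINR}_{e,k}<\beta_e\mid\Phi_e,\Phi_1,\dots,\Phi_K\}\Big].$$ Put $\xi_j=\dfrac{\phi_j^{-1}-1}{M_j-1}$, $C_{\alpha,m}=\dfrac{\Gamma(m-1+\frac2\alpha)\Gamma(1-\frac2\alpha)}{\Gamma(m-1)}$ and $\psi_k=\sum_{j=1}^K\mathcal A_j\lambda_jC_{\alpha,M_j}\Big(\xi_j\dfrac{\phi_j}{\phi_k}\dfrac{P_j}{P_k}\Big)^{\delta}$. **Result.** $$\mathcal P^{int}_{s,k}\le 1-\frac{\lambda_e}{\lambda_e+\psi_k\beta_e^{\delta}}\,(1+\xi_k\beta_e)^{1-M_k},$$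 and, provided that $\phi_j<1$ for at least one tier $j$ (so that $\psi_k>0$), $$\mathcal P^{int}_{s,k}\ge \exp\!\Big(-\lambda_e\,\psi_k^{-1}\beta_e^{-\delta}(1+\xi_k\beta_e)^{1-M_k}\Big).$$ -/

import Mathlib

open MeasureTheory ProbabilityTheory

/-- The plane containing all network nodes, with Euclidean distance. -/
abbrev Plane := EuclideanSpace ℝ (Fin 2)

/-! ### Point processes and laws -/

/-- Number of points of the point process `{X 0, X 1, ...}` that lie in `A`. -/
noncomputable def pointCount {Ω : Type*} (X : ℕ → Ω → Plane) (A : Set Plane) (ω : Ω) : ℕ∞ :=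
  {n : ℕ | X n ω ∈ A}.encard

/-- `X` enumerates the points of a homogeneous Poisson point process of density `lam` on the plane:
counts in measurable sets of finite area are Poisson, with mean `lam` times the area, and counts
in disjoint sets are independent. -/
structure IsPoissonProcess {Ω : Type*} [MeasurableSpace Ω] (μ : Measure Ω)
    (X : ℕ → Ω → Plane) (lam : ℝ) : Prop where
  measurable : ∀ n, Measurable (X n)
  law : ∀ A : Set Plane, MeasurableSet A → volume A ≠ ⊤ → ∀ n : ℕ,
    μ {ω | pointCount X A ω = n} = poissonMeasure (lam * (volume A).toReal).toNNReal {n}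
  indep : ∀ (m : ℕ) (A : Fin m → Set Plane), (∀ i, MeasurableSet (A i)) →
    (∀ i, volume (A i) ≠ ⊤) → Pairwise (fun i j => Disjoint (A i) (A j)) →
    iIndepFun (fun i => pointCount X (A i)) μ

/-- The circularly symmetric complex Gaussian law with mean `0` and variance `1`: real and imaginary
parts are independent real Gaussians with mean `0` and variance `1/2`. -/
noncomputable def stdComplexNormal : Measure ℂ :=
  ((gaussianReal 0 (1 / 2)).prod (gaussianReal 0 (1 / 2))).map (fun p => (⟨p.1, p.2⟩ : ℂ))

/-- The law of a vector of `m` i.i.d. standard complex Gaussian entries. -/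
noncomputable def rayleighLaw (m : ℕ) : Measure (Fin m → ℂ) :=
  Measure.pi (fun _ => stdComplexNormal)

/-! ### Parameters of a `K`-tier heterogeneous cellular network -/

/-- Admissible parameters of a `K`-tier network: path-loss exponent, densities of the base stations,
users and eavesdroppers, transmit powers, antenna numbers, power allocation ratios and access
threshold. -/
structure HCN (K : ℕ) where
  pathExp : ℝ
  bsDensity : Fin K → ℝ
  ueDensity : ℝ
  eveDensity : ℝ
  power : Fin K → ℝ
  antennas : Fin K → ℕ
  ratio : Fin K → ℝ
  threshold : ℝ
  two_lt_pathExp : 2 < pathExp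
  bsDensity_pos : ∀ j, 0 < bsDensity j
  ueDensity_pos : 0 < ueDensity
  eveDensity_pos : 0 < eveDensity
  power_pos : ∀ j, 0 < power j
  two_le_antennas : ∀ j, 2 ≤ antennas j
  ratio_pos : ∀ j, 0 < ratio j
  ratio_le_one : ∀ j, ratio j ≤ 1
  threshold_pos : 0 < threshold

/-- `C_{α,m} = Γ(m-1+2/α) Γ(1-2/α) / Γ(m-1)`. -/
noncomputable def interferenceConst (α : ℝ) (m : ℕ) : ℝ :=
  Real.Gamma ((m : ℝ) - 1 + 2 / α) * Real.Gamma (1 - 2 / α) / Real.Gamma ((m : ℝ) - 1)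

/-- The transmitters seen from an eavesdropper: `none` is the serving base station, and
`some (j, n)` is the `n`-th of the other base stations in tier `j`. -/
abbrev Transmitter (K : ℕ) := Option (Fin K × ℕ)

/-- The tier of a transmitter, when the serving base station belongs to tier `k`. -/
def tierOf {K : ℕ} (k : Fin K) : Transmitter K → Fin K
  | none => k
  | some p => p.1

/-- The gain `r^(-α)` between two points at distance `r` (infinite at `r = 0`). -/
noncomputable def pathGain (α : ℝ) (x y : Plane) : ENNReal :=
  ENNReal.ofReal (dist x y) ^ (-α)

namespace HCN

variable {K : ℕ} (N : HCN K)

/-- `δ = 2 / α`. -/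
noncomputable def delta : ℝ := 2 / N.pathExp

/-- `ξ_j = (φ_j⁻¹ - 1) / (M_j - 1)`. -/
noncomputable def xi (j : Fin K) : ℝ := ((N.ratio j)⁻¹ - 1) / ((N.antennas j : ℝ) - 1)

/-- `Ξ = ∑_j λ_j (P_j M_j)^δ`. -/
noncomputable def Xi : ℝ :=
  ∑ j, N.bsDensity j * (N.power j * N.antennas j) ^ N.delta

/-- `ψ_k = ∑_j A_j λ_j C_{α,M_j} (ξ_j (φ_j/φ_k) (P_j/P_k))^δ` for activation probabilities `A`. -/
noncomputable def psi (A : Fin K → ℝ) (k : Fin K) : ℝ :=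
  ∑ j, A j * N.bsDensity j * interferenceConst N.pathExp (N.antennas j) *
    (N.xi j * (N.ratio j / N.ratio k) * (N.power j / N.power k)) ^ N.delta

/-- The radius `D_j = (P_j M_j / τ)^(1/α)` of the serving region of a base station in tier `j`. -/
noncomputable def servingRadius (j : Fin K) : ℝ :=
  (N.power j * N.antennas j / N.threshold) ^ (1 / N.pathExp)

open Classical in
/-- Truncated average received signal power at `u` from a base station of tier `j` at `z`. -/
noncomputable def truncatedARSP (j : Fin K) (z u : Plane) : ENNReal :=
  if dist z u ≤ N.servingRadius j then
    ENNReal.ofReal (N.power j * N.antennas j) * pathGain N.pathExp z u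
  else 0

/-- A user at `u` is associated with the base station of tier `j` at `z`, when `x i n` are the
other base stations: the latter provides the largest truncated ARSP, and it is not zero. -/
def Associated (x : Fin K → ℕ → Plane) (j : Fin K) (z u : Plane) : Prop :=
  0 < N.truncatedARSP j z u ∧ ∀ i n, N.truncatedARSP i (x i n) u < N.truncatedARSP j z u

/-- The activation probability of tier `j`: the probability that the typical base station of the
tier (placed at the origin, the other base stations being the points of the processes `bs i`)
has at least one associated user. -/
noncomputable def activationProb {Ω : Type*} [MeasurableSpace Ω] (μ : Measure Ω)
    (bs : Fin K → ℕ → Ω → Plane) (ue : ℕ → Ω → Plane) (j : Fin K) : ℝ :=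
  μ.real {ω | ∃ m, N.Associated (fun i n => bs i n ω) j 0 (ue m ω)}

/-- The closed-form expression used for the activation probability of tier `j`,
`1 - exp (-λ_u (P_j M_j)^δ Ξ⁻¹ (1 - exp (-π τ^(-δ) Ξ)))`. -/
noncomputable def activationClosedForm (j : Fin K) : ℝ :=
  1 - Real.exp (-(N.ueDensity * (N.power j * N.antennas j) ^ N.delta * N.Xi⁻¹ *
    (1 - Real.exp (-(Real.pi * N.threshold ^ (-N.delta) * N.Xi)))))

end HCN

/-! ### The random network seen from a serving base station of tier `k` -/

/-- The random objects of the network: locations `bs j n`, `ue n`, `eve m` of base stations (other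
than the serving one), users and eavesdroppers; the indicators `active j n` of active base stations;
the fading vectors `eveChannel z m` from transmitter `z` to eavesdropper `m`; the fading vectors
`ueChannel z` from `z` to the user it serves; the artificial-noise matrices `noiseMatrix z`. -/
structure NetworkVars {K : ℕ} (N : HCN K) (k : Fin K) (Ω : Type*) where
  bs : Fin K → ℕ → Ω → Plane
  ue : ℕ → Ω → Plane
  eve : ℕ → Ω → Plane
  active : Fin K → ℕ → Ω → Bool
  eveChannel : (z : Transmitter K) → ℕ → Ω → (Fin (N.antennas (tierOf k z)) → ℂ)
  ueChannel : (z : Transmitter K) → Ω → (Fin (N.antennas (tierOf k z)) → ℂ)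
  noiseMatrix : (z : Transmitter K) → Ω →
    (Fin (N.antennas (tierOf k z)) → Fin (N.antennas (tierOf k z) - 1) → ℂ)

/-- Labels of the independent sources of randomness. -/
inductive Source (K : ℕ) where
  | bs (j : Fin K)
  | ue
  | eve
  | active (j : Fin K) (n : ℕ)
  | eveChannel (z : Transmitter K) (m : ℕ)
  | beam (z : Transmitter K)

namespace NetworkVars

variable {K : ℕ} {N : HCN K} {k : Fin K} {Ω : Type*} (V : NetworkVars N k Ω)

/-- The σ-algebra generated by one source of randomness. The artificial-noise matrix of a
transmitter is chosen with its beamforming vector, so both belong to one source. -/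
@[reducible] noncomputable def sourceSigma : Source K → MeasurableSpace Ω
  | .bs j => MeasurableSpace.comap (fun ω n => V.bs j n ω) inferInstance
  | .ue => MeasurableSpace.comap (fun ω n => V.ue n ω) inferInstance
  | .eve => MeasurableSpace.comap (fun ω n => V.eve n ω) inferInstance
  | .active j n => MeasurableSpace.comap (V.active j n) inferInstance
  | .eveChannel z m => MeasurableSpace.comap (V.eveChannel z m) inferInstance
  | .beam z => MeasurableSpace.comap (fun ω => (V.ueChannel z ω, V.noiseMatrix z ω)) inferInstance

/-- The σ-algebra generated by the locations of the eavesdroppers and of all base stations. -/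
@[reducible] noncomputable def locationSigma : MeasurableSpace Ω :=
  V.sourceSigma .eve ⊔ ⨆ j, V.sourceSigma (.bs j)

/-- The beamforming vector `w_z`: the conjugate of the served user's channel, normalized. -/
noncomputable def beam (z : Transmitter K) (ω : Ω) (i : Fin (N.antennas (tierOf k z))) : ℂ :=
  star (V.ueChannel z ω i) / ((√(∑ l, ‖V.ueChannel z ω l‖ ^ 2) : ℝ) : ℂ)

/-- The location of a transmitter, when the serving base station is at `b`. -/
def txLocation (b : Plane) (ω : Ω) : Transmitter K → Plane
  | none => b
  | some p => V.bs p.1 p.2 ω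

/-- Power of the information signal of the serving base station at eavesdropper `m`:
`φ_k P_k |h_beᵀ w_b|² r_be^(-α)`. -/
noncomputable def signalPower (b : Plane) (m : ℕ) (ω : Ω) : ENNReal :=
  ENNReal.ofReal (N.ratio k * N.power k * ‖∑ i, V.eveChannel none m ω i * V.beam none ω i‖ ^ 2) *
    pathGain N.pathExp b (V.eve m ω)

/-- Power of the artificial noise of transmitter `z` at eavesdropper `m`:
`(1-φ_j) P_j ‖h_zeᵀ W_z‖² r_ze^(-α) / (M_j - 1)`, with `j` the tier of `z`. -/
noncomputable def noisePower (b : Plane) (z : Transmitter K) (m : ℕ) (ω : Ω) : ENNReal :=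
  ENNReal.ofReal ((1 - N.ratio (tierOf k z)) * N.power (tierOf k z) *
      (∑ l, ‖∑ i, V.eveChannel z m ω i * V.noiseMatrix z ω i l‖ ^ 2) /
        ((N.antennas (tierOf k z) : ℝ) - 1)) *
    pathGain N.pathExp (V.txLocation b ω z) (V.eve m ω)

/-- SINR of eavesdropper `m` for thermal noise power `N₀`. The information signals of other base
stations are resolved by the eavesdropper, so only the artificial noise of the serving and of the
other active base stations interferes. -/
noncomputable def sinr (N₀ : ℝ) (b : Plane) (m : ℕ) (ω : Ω) : ENNReal :=
  V.signalPower b m ω /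
    (V.noisePower b none m ω +
      (∑' p : Fin K × ℕ, if V.active p.1 p.2 ω then V.noisePower b (some p) m ω else 0) +
      ENNReal.ofReal N₀)

/-- The secrecy probability of tier `k` for SINR threshold `βe`: the expectation, over the locations
of base stations and eavesdroppers, of the product over all eavesdroppers of the conditional
probability, given these locations, that the SINR is below the threshold. -/
noncomputable def secrecyProb [MeasurableSpace Ω] (μ : Measure Ω) (N₀ : ℝ) (b : Plane)
    (βe : ℝ) : ℝ :=
  ∫ ω, ∏' m : ℕ, (μ⟦{ω' | V.sinr N₀ b m ω' < ENNReal.ofReal βe} | V.locationSigma⟧) ω ∂μ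

/-- The probabilistic model. The locations are independent homogeneous Poisson processes, the base
stations of tier `j` are active independently with probability `A j`, all fading vectors have i.i.d.
standard complex Gaussian entries, the beamforming vector and the columns of the artificial-noise
matrix of each transmitter form an orthonormal basis, and all sources are independent. -/
structure IsNetwork [MeasurableSpace Ω] (μ : Measure Ω) (A : Fin K → ℝ) : Prop where
  bs_poisson : ∀ j, IsPoissonProcess μ (V.bs j) (N.bsDensity j)
  ue_poisson : IsPoissonProcess μ V.ue N.ueDensity
  eve_poisson : IsPoissonProcess μ V.eve N.eveDensity
  active_measurable : ∀ j n, Measurable (V.active j n)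
  active_law : ∀ j n, μ.real {ω | V.active j n ω = true} = A j
  eveChannel_measurable : ∀ z m, Measurable (V.eveChannel z m)
  eveChannel_law : ∀ z m, μ.map (V.eveChannel z m) = rayleighLaw _
  ueChannel_measurable : ∀ z, Measurable (V.ueChannel z)
  ueChannel_law : ∀ z, μ.map (V.ueChannel z) = rayleighLaw _
  noiseMatrix_measurable : ∀ z, Measurable (V.noiseMatrix z)
  noiseMatrix_orthonormal : ∀ z, ∀ᵐ ω ∂μ, ∀ l l',
    ∑ i, star (V.noiseMatrix z ω i l) * V.noiseMatrix z ω i l' = if l = l' then 1 else 0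
  noiseMatrix_orthogonal : ∀ z, ∀ᵐ ω ∂μ, ∀ l,
    ∑ i, star (V.beam z ω i) * V.noiseMatrix z ω i l = 0
  independent : iIndep V.sourceSigma μ

end NetworkVars

/-!
Everything is computed with the functions `expNeg t = exp (-t)` and its inverse `negLog`, valued in
`[0, ∞]`, so that infinite products become sums and no case distinction on convergence is needed.

*One eavesdropper.* The beamforming vector and the artificial-noise matrix form a unitary matrix,
and Gaussian vectors are unitarily invariant (`map_rayleighLaw_prodMk`). Hence the signal gain is
exponential, the noise gains are gamma variables of shape `M_j - 1`, and signal and noise of the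
serving base station are independent. Given the locations, the probability that the eavesdropper at
`x` reaches the threshold is the Laplace transform of the interference: the `exposure` of `x`, which
is `κ = (1 + ξ_k β_e) ^ (1 - M_k)` times a product over the other base stations
(`IsNetwork.condProb_sinr_lt`). The secrecy probability is therefore the mean of the product of
`1 - exposure` over all eavesdroppers (`IsNetwork.secrecyProb_eq`).

*Mean exposure.* By the Laplace functional of a Poisson process
(`IsPoissonProcess.lintegral_expNeg_tsum`) and the area integral
`lintegral_one_sub_inv_one_add_pathGain_pow`, the mean of the exposure over the base stations is
`κ exp (-π ψ_k β_e ^ δ |x - b|²)` (`IsNetwork.lintegral_exposure`).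

*Lower bound.* Given the base stations, the mean over the eavesdroppers is
`exp (-λ_e ∫ exposure)`, and Jensen's inequality moves the mean over the base stations into the
exponent (`IsPoissonProcess.expNeg_le_lintegral`). Positivity of `ψ_k` requires that of the
activation probabilities: with positive probability no other base station is near the typical one,
while some user is (`IsNetwork.activationProb_pos`).

*Upper bound.* The mean of the product over the base stations is at most `1` minus the mean exposure
of any single eavesdropper, hence of the nearest one. Its squared distance from the serving base
station is exponential of rate `π λ_e`, which gives the stated fraction
(`IsPoissonProcess.lintegral_le_of_lintegral_eq`).
-/

open scoped ENNReal Topology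
open Filter

/-! ### The exponential `exp (-t)` on `[0, ∞]` -/

/-- The function `t ↦ exp (-t)` from `[0, ∞]` to `[0, 1]`, with `exp (-∞) = 0`. -/
noncomputable def expNeg (t : ℝ≥0∞) : ℝ≥0∞ := EReal.exp (-(t : EReal))

/-- The inverse `u ↦ -log u` of `expNeg`, with `-log 0 = ∞` and the value `0` for `u ≥ 1`. -/
noncomputable def negLog (u : ℝ≥0∞) : ℝ≥0∞ := (-ENNReal.log u).toENNReal

@[simp] lemma expNeg_zero : expNeg 0 = 1 := by simp [expNeg]

@[simp] lemma expNeg_top : expNeg ⊤ = 0 := by simp [expNeg]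

lemma expNeg_ofReal {x : ℝ} (hx : 0 ≤ x) :
    expNeg (ENNReal.ofReal x) = ENNReal.ofReal (Real.exp (-x)) := by
  rw [expNeg, EReal.coe_ennreal_ofReal, max_eq_left hx, ← EReal.coe_neg, EReal.exp_coe]

lemma expNeg_eq_of_ne_top {t : ℝ≥0∞} (ht : t ≠ ⊤) :
    expNeg t = ENNReal.ofReal (Real.exp (-t.toReal)) := by
  rw [← expNeg_ofReal ENNReal.toReal_nonneg, ENNReal.ofReal_toReal ht]

lemma expNeg_add (s t : ℝ≥0∞) : expNeg (s + t) = expNeg s * expNeg t := by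
  rw [expNeg, expNeg, expNeg, EReal.coe_ennreal_add, ← EReal.exp_add, EReal.neg_add
    (Or.inl (EReal.coe_ennreal_ne_bot _)) (Or.inr (EReal.coe_ennreal_ne_bot _)), sub_eq_add_neg]

lemma expNeg_le_one (t : ℝ≥0∞) : expNeg t ≤ 1 := by
  simp [expNeg, EReal.coe_ennreal_nonneg]

lemma expNeg_ne_top (t : ℝ≥0∞) : expNeg t ≠ ⊤ :=
  ne_top_of_le_ne_top ENNReal.one_ne_top (expNeg_le_one t)

lemma expNeg_antitone : Antitone expNeg := fun _ _ h =>
  EReal.exp_monotone (EReal.neg_le_neg_iff.2 (EReal.coe_ennreal_le_coe_ennreal_iff.2 h))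

lemma continuous_expNeg : Continuous expNeg :=
  ENNReal.continuous_exp.comp (continuous_neg.comp continuous_coe_ennreal_ereal)

lemma measurable_expNeg : Measurable expNeg := continuous_expNeg.measurable

lemma measurable_negLog : Measurable negLog := by
  unfold negLog
  fun_prop

lemma expNeg_negLog {u : ℝ≥0∞} (hu : u ≤ 1) : expNeg (negLog u) = u := by
  rw [expNeg, negLog, EReal.coe_toENNReal, neg_neg, ENNReal.exp_log]
  rw [← EReal.neg_le_neg_iff]
  simpa using hu

lemma expNeg_sum {ι : Type*} (s : Finset ι) (t : ι → ℝ≥0∞) :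
    expNeg (∑ i ∈ s, t i) = ∏ i ∈ s, expNeg (t i) := by
  classical
  induction s using Finset.induction_on with
  | empty => simp
  | insert a s ha ih => rw [Finset.sum_insert ha, Finset.prod_insert ha, expNeg_add, ih]

lemma tendsto_prod_expNeg {ι : Type*} (t : ι → ℝ≥0∞) :
    Tendsto (fun s : Finset ι => ∏ i ∈ s, expNeg (t i)) atTop (𝓝 (expNeg (∑' i, t i))) := by
  simp_rw [← expNeg_sum]
  exact (continuous_expNeg.tendsto _).comp ENNReal.summable.hasSum

lemma tprod_toReal_expNeg {ι : Type*} (t : ι → ℝ≥0∞) :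
    ∏' i, (expNeg (t i)).toReal = (expNeg (∑' i, t i)).toReal := by
  apply HasProd.tprod_eq
  have := (ENNReal.tendsto_toReal (expNeg_ne_top _)).comp (tendsto_prod_expNeg t)
  refine this.congr fun s => ?_
  simp [ENNReal.toReal_prod]

/-! ### Independence -/

/-- Tonelli's theorem for independent random variables, with both averages taken over the common
probability space. -/
lemma ProbabilityTheory.IndepFun.lintegral_prodMk {Ω α β : Type*} [MeasurableSpace Ω]
    [MeasurableSpace α] [MeasurableSpace β] {μ : Measure Ω} [IsProbabilityMeasure μ]
    {Y : Ω → α} {Z : Ω → β} (h : IndepFun Y Z μ) (hY : Measurable Y) (hZ : Measurable Z)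
    {F : α → β → ℝ≥0∞} (hF : Measurable (Function.uncurry F)) :
    ∫⁻ ω, F (Y ω) (Z ω) ∂μ = ∫⁻ ω, ∫⁻ ω', F (Y ω) (Z ω') ∂μ ∂μ := by
  have := Measure.isProbabilityMeasure_map (μ := μ) hY.aemeasurable
  have := Measure.isProbabilityMeasure_map (μ := μ) hZ.aemeasurable
  have e := (indepFun_iff_map_prod_eq_prod_map_map hY.aemeasurable hZ.aemeasurable).1 h
  calc ∫⁻ ω, F (Y ω) (Z ω) ∂μ
      = ∫⁻ p, Function.uncurry F p ∂(μ.map fun ω => (Y ω, Z ω)) := by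
        rw [lintegral_map hF (hY.prodMk hZ)]; rfl
    _ = ∫⁻ y, ∫⁻ z, F y z ∂(μ.map Z) ∂(μ.map Y) := by
        rw [e, lintegral_prod _ hF.aemeasurable]; rfl
    _ = ∫⁻ ω, ∫⁻ z, F (Y ω) z ∂(μ.map Z) ∂μ := by
        exact lintegral_map hF.lintegral_prod_right' hY
    _ = _ := by
        refine lintegral_congr fun ω => ?_
        exact lintegral_map (hF.comp (measurable_const.prodMk measurable_id)) hZ

/-- Conditional probability by freezing: if `L` is known and `R` is independent of the
conditioning σ-algebra `m`, the conditional probability of an event about `(L, R)` is obtained by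
averaging over `R` alone. -/
lemma condExp_indicator_prodMk_of_indep {Ω α β : Type*} {m : MeasurableSpace Ω}
    [mΩ : MeasurableSpace Ω] [MeasurableSpace α] [mβ : MeasurableSpace β] {μ : Measure Ω}
    [IsProbabilityMeasure μ]
    (hm : m ≤ mΩ) {Y : Ω → α} {Z : Ω → β} (hY : Measurable[m] Y)
    (hZ : Measurable Z) (h : Indep m (mβ.comap Z) μ) {S : Set (α × β)} (hS : MeasurableSet S) :
    μ⟦{ω | (Y ω, Z ω) ∈ S} | m⟧ =ᵐ[μ] fun ω => μ.real {ω' | (Y ω, Z ω') ∈ S} := by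
  have hYm : Measurable Y := hY.mono hm le_rfl
  have hG : Measurable fun y => μ {ω' | (y, Z ω') ∈ S} := by
    have h1 : MeasurableSet {p : α × Ω | (p.1, Z p.2) ∈ S} :=
      (measurable_fst.prodMk (hZ.comp measurable_snd)) hS
    exact measurable_measure_prodMk_left (ν := μ) h1
  have hA : MeasurableSet {ω | (Y ω, Z ω) ∈ S} := (hYm.prodMk hZ) hS
  symm
  refine ae_eq_condExp_of_forall_setIntegral_eq hm ?_ ?_ ?_ ?_
  · exact (integrable_const (1 : ℝ)).indicator hA
  · intro s _ _
    refine Integrable.integrableOn (Integrable.of_bound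
      ((hG.comp hYm).ennreal_toReal).aestronglyMeasurable 1 (ae_of_all _ fun ω => ?_))
    simp only [Real.norm_eq_abs]
    rw [abs_of_nonneg (by positivity)]
    exact measureReal_le_one
  · intro s hs _
    have hs' := hm s hs
    classical
    -- attaching the indicator of the conditioning event to `Y` keeps the pair independent of `Z`
    have hI : IndepFun (fun ω => (Y ω, s.indicator (fun _ => (1 : ℝ≥0∞)) ω)) Z μ := by
      refine indep_of_indep_of_le_left h ?_
      have : Measurable[m] (fun ω => (Y ω, s.indicator (fun _ => (1 : ℝ≥0∞)) ω)) :=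
        hY.prodMk (measurable_const.indicator hs)
      exact this.comap_le
    have key := hI.lintegral_prodMk (hYm.prodMk (measurable_const.indicator hs')) hZ
      (F := fun p z => p.2 * S.indicator (fun _ => 1) (p.1, z)) (by
        refine (measurable_snd.comp measurable_fst).mul ?_
        exact (measurable_const.indicator hS).comp
          ((measurable_fst.comp measurable_fst).prodMk measurable_snd))
    have e1 : ∫⁻ ω, s.indicator (fun _ => (1 : ℝ≥0∞)) ω * S.indicator (fun _ => 1) (Y ω, Z ω) ∂μ
        = μ (s ∩ {ω | (Y ω, Z ω) ∈ S}) := by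
      rw [← lintegral_indicator_one (hs'.inter hA)]
      refine lintegral_congr fun ω => ?_
      by_cases h1 : ω ∈ s <;> by_cases h2 : (Y ω, Z ω) ∈ S <;> simp [h1, h2]
    have e2 : ∀ ω, ∫⁻ ω', s.indicator (fun _ => (1 : ℝ≥0∞)) ω *
        S.indicator (fun _ => 1) (Y ω, Z ω') ∂μ
        = s.indicator (fun ω => μ {ω' | (Y ω, Z ω') ∈ S}) ω := by
      intro ω
      have hA' : MeasurableSet {ω' | (Y ω, Z ω') ∈ S} := (measurable_const.prodMk hZ) hS
      have : ∫⁻ ω', S.indicator (fun _ => (1 : ℝ≥0∞)) (Y ω, Z ω') ∂μ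
          = μ {ω' | (Y ω, Z ω') ∈ S} := by
        rw [← lintegral_indicator_one hA']
        rfl
      by_cases h1 : ω ∈ s <;> simp [h1, this]
    rw [e1, lintegral_congr e2, lintegral_indicator hs'] at key
    have hm1 : ∫ x in s, μ.real {ω' | (Y x, Z ω') ∈ S} ∂μ
        = (∫⁻ ω in s, μ {ω' | (Y ω, Z ω') ∈ S} ∂μ).toReal := by
      exact integral_toReal (hG.comp hYm).aemeasurable (ae_of_all _ fun ω => measure_lt_top _ _)
    rw [hm1, ← key, integral_indicator hA]
    simp [Set.inter_comm, measureReal_def, Measure.restrict_apply hA]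
  · exact ((hG.comp hY).ennreal_toReal).stronglyMeasurable.aestronglyMeasurable

/-- Functions depending on disjoint groups of independent sources factorize. -/
lemma ProbabilityTheory.iIndep.lintegral_prod_of_disjoint {Ω ι σ : Type*} [mΩ : MeasurableSpace Ω]
    {μ : Measure Ω} [IsProbabilityMeasure μ] {m : σ → MeasurableSpace Ω} (hm : ∀ s, m s ≤ mΩ)
    (h : iIndep m μ) {S : ι → Set σ} (hS : Pairwise fun i j => Disjoint (S i) (S j))
    {F : ι → Ω → ℝ≥0∞} (hF : ∀ i, Measurable[⨆ s ∈ S i, m s] (F i)) (t : Finset ι) :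
    ∫⁻ ω, ∏ i ∈ t, F i ω ∂μ = ∏ i ∈ t, ∫⁻ ω, F i ω ∂μ := by
  classical
  induction t using Finset.induction_on with
  | empty => simp
  | insert a t ha ih =>
    simp_rw [Finset.prod_insert ha]
    rw [← ih]
    have hle : ∀ T : Set σ, (⨆ s ∈ T, m s) ≤ mΩ := fun T => iSup₂_le fun s _ => hm s
    have hd : Disjoint (S a) (⋃ i ∈ t, S i) := by
      simp only [Set.disjoint_iUnion_right]
      intro i hi
      exact hS (fun e => ha (e ▸ hi))
    refine lintegral_mul_eq_lintegral_mul_lintegral_of_independent_measurableSpace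
      (hle _) (hle _) (indep_iSup_of_disjoint hm h hd) (hF a) ?_
    refine Finset.measurable_fun_prod (m := ⨆ s ∈ ⋃ i ∈ t, S i, m s) t fun i hi => ?_
    exact (hF i).mono (biSup_mono fun s hs => Set.mem_biUnion hi hs) le_rfl

/-- The Laplace transform of a countable sum of functions of disjoint groups of independent
sources is the product of the Laplace transforms. -/
lemma ProbabilityTheory.iIndep.lintegral_expNeg_tsum {Ω ι σ : Type*} [mΩ : MeasurableSpace Ω]
    [Countable ι]
    {μ : Measure Ω} [IsProbabilityMeasure μ] {m : σ → MeasurableSpace Ω} (hm : ∀ s, m s ≤ mΩ)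
    (h : iIndep m μ) {S : ι → Set σ} (hS : Pairwise fun i j => Disjoint (S i) (S j))
    {X : ι → Ω → ℝ≥0∞} (hX : ∀ i, Measurable[⨆ s ∈ S i, m s] (X i)) {f : ι → ℝ≥0∞}
    (hf : ∀ i, ∫⁻ ω, expNeg (X i ω) ∂μ = expNeg (f i)) :
    ∫⁻ ω, expNeg (∑' i, X i ω) ∂μ = expNeg (∑' i, f i) := by
  have hle : ∀ T : Set σ, (⨆ s ∈ T, m s) ≤ mΩ := fun T => iSup₂_le fun s _ => hm s
  have hX' : ∀ i, Measurable (X i) := fun i => (hX i).mono (hle _) le_rfl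
  have h1 : Tendsto (fun s : Finset ι => ∫⁻ ω, ∏ i ∈ s, expNeg (X i ω) ∂μ) atTop
      (𝓝 (∫⁻ ω, expNeg (∑' i, X i ω) ∂μ)) := by
    refine tendsto_lintegral_filter_of_dominated_convergence (fun _ => 1)
      (Eventually.of_forall fun s => ?_) (Eventually.of_forall fun s => ae_of_all _ fun ω => ?_)
      (by simp) (ae_of_all _ fun ω => tendsto_prod_expNeg _)
    · exact Finset.measurable_fun_prod s fun i _ => measurable_expNeg.comp (hX' i)
    · exact Finset.prod_le_one' fun i _ => expNeg_le_one _
  refine tendsto_nhds_unique h1 ((tendsto_prod_expNeg f).congr fun s => ?_)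
  rw [h.lintegral_prod_of_disjoint hm hS (F := fun i ω => expNeg (X i ω))
    (fun i => measurable_expNeg.comp (hX i))]
  simp [hf]

/-! ### Poisson processes -/

lemma coe_pointCount {Ω : Type*} (X : ℕ → Ω → Plane) {A : Set Plane} (hA : MeasurableSet A)
    (ω : Ω) : ((pointCount X A ω : ℕ∞) : ℝ≥0∞) =
      (Measure.sum fun n => Measure.dirac (X n ω)) A := by
  rw [Measure.sum_apply _ hA, pointCount, ← ENNReal.tsum_set_one,
    tsum_subtype {n : ℕ | X n ω ∈ A} fun _ => (1 : ℝ≥0∞)]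
  refine tsum_congr fun n => ?_
  rw [Measure.dirac_apply' _ hA]
  rfl

lemma IsPoissonProcess.measurable_pointCount {Ω : Type*} [MeasurableSpace Ω] {μ : Measure Ω}
    {X : ℕ → Ω → Plane} {lam : ℝ} (h : IsPoissonProcess μ X lam) {A : Set Plane}
    (hA : MeasurableSet A) : Measurable (pointCount X A) := by
  have h1 : Measurable fun ω => ((pointCount X A ω : ℕ∞) : ℝ≥0∞) := by
    simp_rw [coe_pointCount X hA, Measure.sum_apply _ hA, Measure.dirac_apply' _ hA]
    refine Measurable.tsum fun n => ?_
    exact (measurable_one.indicator hA).comp (h.measurable n)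
  refine measurable_to_countable' fun a => ?_
  have : pointCount X A ⁻¹' {a} = (fun ω => ((pointCount X A ω : ℕ∞) : ℝ≥0∞)) ⁻¹' {(a : ℝ≥0∞)} := by
    ext ω
    simp
  rw [this]
  exact h1 (measurableSet_singleton _)

/-- The probability generating function of the Poisson law, at `exp (-c)`. -/
lemma lintegral_expNeg_poissonMeasure (r : NNReal) (c : ℝ≥0∞) :
    ∫⁻ n : ℕ, expNeg (c * n) ∂(poissonMeasure r) = expNeg (r * (1 - expNeg c)) := by
  set u := (expNeg c).toReal with hu
  have hu0 : 0 ≤ u := ENNReal.toReal_nonneg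
  have hu1 : u ≤ 1 := by
    rw [← ENNReal.toReal_one]
    exact ENNReal.toReal_mono ENNReal.one_ne_top (expNeg_le_one c)
  have hcu : expNeg c = ENNReal.ofReal u := (ENNReal.ofReal_toReal (expNeg_ne_top c)).symm
  have hpow : ∀ n : ℕ, expNeg (c * n) = ENNReal.ofReal (u ^ n) := by
    intro n
    rw [ENNReal.ofReal_pow hu0, ← hcu]
    induction n with
    | zero => simp
    | succ n ih => rw [Nat.cast_succ, mul_add, mul_one, expNeg_add, ih, pow_succ]
  have h1 : (r : ℝ≥0∞) * (1 - expNeg c) = ENNReal.ofReal (r * (1 - u)) := by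
    rw [hcu, ENNReal.ofReal_mul r.coe_nonneg, ENNReal.ofReal_sub _ hu0, ENNReal.ofReal_one,
      ENNReal.ofReal_coe_nnreal]
  rw [h1, expNeg_ofReal (mul_nonneg r.coe_nonneg (by linarith)), poissonMeasure,
    lintegral_sum_measure]
  simp_rw [lintegral_smul_measure, lintegral_dirac, hpow, smul_eq_mul]
  have hs : HasSum (fun n : ℕ => Real.exp (-r) * r ^ n / (n.factorial : ℝ) * u ^ n)
      (Real.exp (-(r * (1 - u)))) := by
    convert! (NormedSpace.expSeries_div_hasSum_exp ((r : ℝ) * u)).mul_left (Real.exp (-r)) using 1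
    · ext n; rw [mul_pow]; ring
    · rw [← Real.exp_eq_exp_ℝ, ← Real.exp_add]; ring_nf
  rw [← hs.tsum_eq, ENNReal.ofReal_tsum_of_nonneg (fun n => by positivity) hs.summable]
  refine tsum_congr fun n => ?_
  rw [← ENNReal.ofReal_mul (by positivity)]

lemma IsPoissonProcess.map_pointCount {Ω : Type*} [MeasurableSpace Ω] {μ : Measure Ω}
    [IsProbabilityMeasure μ] {X : ℕ → Ω → Plane} {lam : ℝ} (h : IsPoissonProcess μ X lam)
    {A : Set Plane} (hA : MeasurableSet A) (hA' : volume A ≠ ⊤) :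
    μ.map (pointCount X A) =
      (poissonMeasure (lam * (volume A).toReal).toNNReal).map (Nat.cast : ℕ → ℕ∞) := by
  set P := poissonMeasure (lam * (volume A).toReal).toNNReal
  have hm := h.measurable_pointCount hA
  have i1 := Measure.isProbabilityMeasure_map (μ := μ) hm.aemeasurable
  have i2 := Measure.isProbabilityMeasure_map (μ := P) (f := (Nat.cast : ℕ → ℕ∞))
    (measurable_of_countable _).aemeasurable
  have hn : ∀ n : ℕ, μ.map (pointCount X A) {(n : ℕ∞)} = P.map (Nat.cast : ℕ → ℕ∞) {(n : ℕ∞)} := by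
    intro n
    rw [Measure.map_apply hm (measurableSet_singleton _),
      Measure.map_apply (measurable_of_countable _) (measurableSet_singleton _)]
    have : (Nat.cast : ℕ → ℕ∞) ⁻¹' {(n : ℕ∞)} = {n} := by ext; simp
    rw [this]
    exact h.law A hA hA' n
  rw [Measure.ext_iff_singleton]
  intro a
  induction a with
  | coe n => exact hn n
  | top =>
    have hc : ({⊤} : Set ℕ∞) = (⋃ n : ℕ, {(n : ℕ∞)})ᶜ := by
      ext a
      induction a <;> simp
    rw [hc, prob_compl_eq_one_sub (MeasurableSet.iUnion fun n => measurableSet_singleton _),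
      prob_compl_eq_one_sub (MeasurableSet.iUnion fun n => measurableSet_singleton _)]
    congr 1
    have hd : Pairwise (Function.onFun Disjoint fun n : ℕ => ({(n : ℕ∞)} : Set ℕ∞)) := by
      intro i j hij
      simpa [Function.onFun] using hij
    rw [measure_iUnion hd (fun n => measurableSet_singleton _),
      measure_iUnion hd (fun n => measurableSet_singleton _)]
    exact tsum_congr hn

lemma IsPoissonProcess.lintegral_expNeg_pointCount {Ω : Type*} [MeasurableSpace Ω] {μ : Measure Ω}
    [IsProbabilityMeasure μ] {X : ℕ → Ω → Plane} {lam : ℝ} (h : IsPoissonProcess μ X lam)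
    {A : Set Plane} (hA : MeasurableSet A) (hA' : volume A ≠ ⊤) (c : ℝ≥0∞) :
    ∫⁻ ω, expNeg (c * (pointCount X A ω : ℕ∞)) ∂μ =
      expNeg (ENNReal.ofReal lam * ((1 - expNeg c) * volume A)) := by
  have e1 : ∫⁻ ω, expNeg (c * (pointCount X A ω : ℕ∞)) ∂μ =
      ∫⁻ n : ℕ∞, expNeg (c * n) ∂(μ.map (pointCount X A)) := by
    rw [lintegral_map (measurable_of_countable _) (h.measurable_pointCount hA)]
  rw [e1, h.map_pointCount hA hA', lintegral_map (measurable_of_countable _)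
    (measurable_of_countable _)]
  simp only [ENat.toENNReal_coe]
  rw [lintegral_expNeg_poissonMeasure]
  congr 1
  change ENNReal.ofReal (lam * (volume A).toReal) * _ = _
  rw [ENNReal.ofReal_mul' (by positivity), ENNReal.ofReal_toReal hA', mul_assoc,
    mul_comm (volume A)]

/-- The Laplace functional at a simple function with support of finite area. -/
lemma IsPoissonProcess.lintegral_expNeg_simpleFunc {Ω : Type*} [MeasurableSpace Ω] {μ : Measure Ω}
    [IsProbabilityMeasure μ] {X : ℕ → Ω → Plane} {lam : ℝ} (h : IsPoissonProcess μ X lam)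
    (f : SimpleFunc Plane ℝ≥0∞) (hf : ∀ c ≠ 0, volume (f ⁻¹' {c}) ≠ ⊤) :
    ∫⁻ ω, expNeg (∑' n, f (X n ω)) ∂μ =
      expNeg (ENNReal.ofReal lam * ∫⁻ x, (1 - expNeg (f x))) := by
  classical
  set s := f.range.filter (· ≠ 0) with hs
  set e : Fin s.card ≃ s := s.equivFin.symm
  set A : Fin s.card → Set Plane := fun i => f ⁻¹' {(e i : ℝ≥0∞)}
  have hAm : ∀ i, MeasurableSet (A i) := fun i => f.measurableSet_fiber _
  have hne : ∀ i, (e i : ℝ≥0∞) ≠ 0 := fun i => (Finset.mem_filter.1 (e i).2).2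
  have hAv : ∀ i, volume (A i) ≠ ⊤ := fun i => hf _ (hne i)
  have hAd : Pairwise fun i j => Disjoint (A i) (A j) := by
    intro i j hij
    refine Disjoint.preimage _ (Set.disjoint_singleton.2 fun hc => hij ?_)
    exact e.injective (Subtype.ext hc)
  have hsum : ∀ (g : ℝ≥0∞ → ℝ≥0∞) (_ : g 0 = 0) (ν : Measure Plane),
      ∫⁻ x, g (f x) ∂ν = ∑ i, g (e i) * ν (A i) := by
    intro g hg ν
    have h1 : ∫⁻ x, g (f x) ∂ν = ∑ c ∈ f.range, g c * ν (f ⁻¹' {c}) := by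
      rw [← SimpleFunc.map_lintegral, ← SimpleFunc.lintegral_eq_lintegral]
      rfl
    have h2 : ∑ c ∈ s, g c * ν (f ⁻¹' {c}) = ∑ c ∈ f.range, g c * ν (f ⁻¹' {c}) := by
      refine Finset.sum_filter_of_ne fun c _ hc h0 => hc ?_
      rw [h0, hg, zero_mul]
    rw [h1, ← h2, ← Finset.sum_coe_sort s]
    exact (Equiv.sum_comp e fun c : s => g c * ν (f ⁻¹' {(c : ℝ≥0∞)})).symm
  -- the sum over the points is the integral against the counting measure of the process
  have h1 : ∀ ω, ∑' n, f (X n ω) = ∑ i, (e i : ℝ≥0∞) * (pointCount X (A i) ω : ℕ∞) := by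
    intro ω
    have := hsum id rfl (Measure.sum fun n => Measure.dirac (X n ω))
    rw [lintegral_sum_measure] at this
    simpa [lintegral_dirac, coe_pointCount X (hAm _)] using this
  simp_rw [h1, expNeg_sum]
  have hind : iIndep (fun i => MeasurableSpace.comap (pointCount X (A i)) inferInstance) μ :=
    h.indep _ A hAm hAv hAd
  rw [hind.lintegral_prod_of_disjoint (S := fun i => {i})
    (fun i => (h.measurable_pointCount (hAm i)).comap_le)
    (fun i j hij => by simpa using hij)
    (F := fun i ω => expNeg ((e i : ℝ≥0∞) * (pointCount X (A i) ω : ℕ∞)))]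
  · simp_rw [h.lintegral_expNeg_pointCount (hAm _) (hAv _)]
    rw [← expNeg_sum, hsum (fun c => 1 - expNeg c) (by simp), Finset.mul_sum]
  · intro i
    rw [iSup_singleton]
    exact (measurable_of_countable fun a : ℕ∞ => expNeg ((e i : ℝ≥0∞) * a)).comp
      (comap_measurable (pointCount X (A i)))

/-- The Laplace functional of a homogeneous Poisson process (its probability generating
functional at `exp (-f)`). -/
lemma IsPoissonProcess.lintegral_expNeg_tsum {Ω : Type*} [MeasurableSpace Ω] {μ : Measure Ω}
    [IsProbabilityMeasure μ] {X : ℕ → Ω → Plane} {lam : ℝ} (h : IsPoissonProcess μ X lam)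
    {f : Plane → ℝ≥0∞} (hf : Measurable f) :
    ∫⁻ ω, expNeg (∑' n, f (X n ω)) ∂μ =
      expNeg (ENNReal.ofReal lam * ∫⁻ x, (1 - expNeg (f x))) := by
  -- simple functions with support of finite area increase to `f`
  set g : ℕ → SimpleFunc Plane ℝ≥0∞ := fun k =>
    (SimpleFunc.eapprox f k).restrict (Metric.ball 0 k)
  have hg : ∀ k x, g k x = (Metric.ball (0 : Plane) k).indicator (SimpleFunc.eapprox f k) x :=
    fun k x => by rw [SimpleFunc.restrict_apply _ measurableSet_ball]
  have hmono : ∀ x, Monotone fun k => g k x := by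
    intro x k l hkl
    simp only [hg]
    refine (Set.indicator_le_indicator_of_subset
      (Metric.ball_subset_ball (Nat.cast_le.2 hkl)) (fun _ => zero_le) x).trans ?_
    exact Set.indicator_le_indicator (SimpleFunc.monotone_eapprox f hkl x)
  have hlim : ∀ x, Tendsto (fun k => g k x) atTop (𝓝 (f x)) := by
    intro x
    refine (SimpleFunc.tendsto_eapprox hf x).congr' ?_
    obtain ⟨N, hN⟩ := exists_nat_gt ‖x‖
    filter_upwards [eventually_ge_atTop N] with k hk
    rw [hg, Set.indicator_of_mem]
    rw [mem_ball_zero_iff]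
    exact hN.trans_le (by exact_mod_cast hk)
  have hfin : ∀ k, ∀ c ≠ 0, volume (g k ⁻¹' {c}) ≠ ⊤ := by
    intro k c hc
    refine ne_top_of_le_ne_top (measure_ball_lt_top (x := (0 : Plane)) (r := k)).ne
      (measure_mono fun x hx => ?_)
    by_contra hxb
    apply hc
    rw [← Set.mem_singleton_iff.1 hx, hg, Set.indicator_of_notMem hxb]
  have hL : Tendsto (fun k => ∫⁻ ω, expNeg (∑' n, g k (X n ω)) ∂μ) atTop
      (𝓝 (∫⁻ ω, expNeg (∑' n, f (X n ω)) ∂μ)) := by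
    refine tendsto_lintegral_of_dominated_convergence (fun _ => 1) (fun k => ?_)
      (fun k => ae_of_all _ fun ω => expNeg_le_one _) (by simp) (ae_of_all _ fun ω => ?_)
    · exact measurable_expNeg.comp
        (Measurable.tsum fun n => (g k).measurable.comp (h.measurable n))
    · refine (continuous_expNeg.tendsto _).comp ?_
      have := lintegral_tendsto_of_tendsto_of_monotone (μ := Measure.count)
        (f := fun k n => g k (X n ω)) (F := fun n => f (X n ω))
        (fun k => (measurable_of_countable _).aemeasurable)
        (ae_of_all _ fun n => hmono _) (ae_of_all _ fun n => hlim _)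
      simpa [lintegral_count] using this
  have hR : Tendsto (fun k => ∫⁻ x, (1 - expNeg (g k x))) atTop
      (𝓝 (∫⁻ x, (1 - expNeg (f x)))) := by
    refine lintegral_tendsto_of_tendsto_of_monotone (fun k => ?_) (ae_of_all _ fun x => ?_)
      (ae_of_all _ fun x => ?_)
    · exact (measurable_const.sub (measurable_expNeg.comp (g k).measurable)).aemeasurable
    · intro k l hkl
      exact tsub_le_tsub_left (expNeg_antitone (hmono x hkl)) 1
    · exact ENNReal.Tendsto.sub tendsto_const_nhds
        ((continuous_expNeg.tendsto _).comp (hlim x)) (Or.inl ENNReal.one_ne_top)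
  refine tendsto_nhds_unique hL ?_
  simp_rw [fun k => h.lintegral_expNeg_simpleFunc (g k) (hfin k)]
  exact (continuous_expNeg.tendsto _).comp
    (ENNReal.Tendsto.const_mul hR (Or.inr ENNReal.ofReal_ne_top))

/-- Void probabilities. -/
lemma IsPoissonProcess.measure_forall_notMem {Ω : Type*} [MeasurableSpace Ω] {μ : Measure Ω}
    [IsProbabilityMeasure μ] {X : ℕ → Ω → Plane} {lam : ℝ} (h : IsPoissonProcess μ X lam)
    {A : Set Plane} (hA : MeasurableSet A) :
    μ {ω | ∀ n, X n ω ∉ A} = expNeg (ENNReal.ofReal lam * volume A) := by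
  classical
  -- the functional at `∞` on `A` and `0` elsewhere is the indicator of the void event
  have h1 := h.lintegral_expNeg_tsum (f := A.indicator fun _ => ⊤) (measurable_const.indicator hA)
  have h2 : ∀ x, 1 - expNeg (A.indicator (fun _ => ⊤) x) = A.indicator 1 x := by
    intro x
    by_cases hx : x ∈ A <;> simp [hx]
  have hm : MeasurableSet {ω | ∀ n, X n ω ∉ A} := by
    simp only [Set.ofPred_forall]
    exact MeasurableSet.iInter fun n => (h.measurable n) hA.compl
  have h3 : ∀ ω, expNeg (∑' n, A.indicator (fun _ => ⊤) (X n ω)) =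
      {ω | ∀ n, X n ω ∉ A}.indicator 1 ω := by
    intro ω
    by_cases hω : ∀ n, X n ω ∉ A
    · simp [hω]
    · rw [Set.indicator_of_notMem (by exact hω)]
      push Not at hω
      obtain ⟨n, hn⟩ := hω
      rw [ENNReal.tsum_eq_top_of_eq_top ⟨n, by simp [hn]⟩, expNeg_top]
  simp_rw [h2, h3] at h1
  rwa [lintegral_indicator_one hm, lintegral_indicator_one hA] at h1

/-! ### Complex Gaussian vectors -/

instance : IsProbabilityMeasure stdComplexNormal := by
  unfold stdComplexNormal
  exact Measure.isProbabilityMeasure_map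
    (Complex.measurableEquivRealProd.symm.measurable).aemeasurable

instance (m : ℕ) : IsProbabilityMeasure (rayleighLaw m) := by
  unfold rayleighLaw
  infer_instance

lemma lintegral_stdComplexNormal {f : ℂ → ℝ≥0∞} (hf : Measurable f) :
    ∫⁻ z, f z ∂stdComplexNormal =
      ∫⁻ z : ℂ, ENNReal.ofReal (Real.pi⁻¹ * Real.exp (-‖z‖ ^ 2)) * f z := by
  have hm : Measurable fun p : ℝ × ℝ => (⟨p.1, p.2⟩ : ℂ) :=
    Complex.measurableEquivRealProd.symm.measurable
  have hfm : Measurable fun p : ℝ × ℝ => f ⟨p.1, p.2⟩ := hf.comp hm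
  have hv : (1 / 2 : NNReal) ≠ 0 := by norm_num
  rw [stdComplexNormal, lintegral_map hf hm, gaussianReal_of_var_ne_zero _ hv,
    prod_withDensity (measurable_gaussianPDF _ _) (measurable_gaussianPDF _ _),
    lintegral_withDensity_eq_lintegral_mul _ (by fun_prop) hfm]
  rw [← (Complex.volume_preserving_equiv_real_prod.symm).lintegral_comp (by fun_prop)]
  refine lintegral_congr fun p => ?_
  simp only [Pi.mul_apply]
  congr 1
  rw [gaussianPDF, gaussianPDF, ← ENNReal.ofReal_mul (gaussianPDFReal_nonneg _ _ _)]
  congr 1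
  rw [gaussianPDFReal, gaussianPDFReal]
  have h1 : ‖Complex.measurableEquivRealProd.symm p‖ ^ 2 = p.1 ^ 2 + p.2 ^ 2 := by
    rw [Complex.sq_norm, Complex.normSq_apply]
    simp [Complex.measurableEquivRealProd_symm_apply, sq]
  rw [h1, mul_mul_mul_comm, ← Real.exp_add]
  have h2 : ((1 / 2 : NNReal) : ℝ) = 1 / 2 := by norm_num
  rw [h2, ← mul_inv, ← sq, Real.sq_sqrt (by positivity)]
  congr 2 <;> ring

/-- The squared modulus of a standard complex Gaussian is exponential of rate one: its Laplace
transform, truncated below at `c`. -/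
lemma lintegral_stdComplexNormal_expNeg {s c : ℝ} (hs : 0 ≤ s) (hc : 0 ≤ c) :
    ∫⁻ z, {z : ℂ | c ≤ ‖z‖ ^ 2}.indicator
      (fun z => expNeg (ENNReal.ofReal s * ENNReal.ofReal (‖z‖ ^ 2))) z ∂stdComplexNormal =
      ENNReal.ofReal (Real.exp (-((1 + s) * c)) / (1 + s)) := by
  have hset : MeasurableSet {z : ℂ | c ≤ ‖z‖ ^ 2} :=
    measurableSet_le measurable_const (by fun_prop)
  have hmeas : Measurable ({z : ℂ | c ≤ ‖z‖ ^ 2}.indicator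
      (fun z => expNeg (ENNReal.ofReal s * ENNReal.ofReal (‖z‖ ^ 2)))) :=
    (measurable_expNeg.comp (by fun_prop)).indicator hset
  rw [lintegral_stdComplexNormal hmeas, ← Complex.lintegral_comp_polarCoord_symm]
  set g : ℝ → ℝ≥0∞ := (Set.Ici (√c)).indicator
    fun r => ENNReal.ofReal (Real.pi⁻¹ * (r * Real.exp (-((1 + s) * r ^ 2)))) with hg
  have hgm : Measurable g := by
    refine Measurable.indicator ?_ measurableSet_Ici
    fun_prop
  have h1 : ∀ p ∈ polarCoord.target, ENNReal.ofReal p.1 •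
      (ENNReal.ofReal (Real.pi⁻¹ * Real.exp (-‖Complex.polarCoord.symm p‖ ^ 2)) *
        {z : ℂ | c ≤ ‖z‖ ^ 2}.indicator
          (fun z => expNeg (ENNReal.ofReal s * ENNReal.ofReal (‖z‖ ^ 2)))
          (Complex.polarCoord.symm p)) = g p.1 := by
    intro p hp
    have hp0 : 0 < p.1 := hp.1
    rw [hg, Set.indicator_apply, Set.indicator_apply]
    have hiff : (Complex.polarCoord.symm p ∈ {z : ℂ | c ≤ ‖z‖ ^ 2}) ↔ p.1 ∈ Set.Ici (√c) := by
      simp only [Set.mem_ofPred_eq, Set.mem_Ici, Complex.norm_polarCoord_symm, sq_abs]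
      rw [Real.sqrt_le_left hp0.le]
    by_cases h : p.1 ∈ Set.Ici (√c)
    · rw [if_pos (hiff.2 h), if_pos h, ← ENNReal.ofReal_mul hs, expNeg_ofReal (by positivity),
        smul_eq_mul, ← ENNReal.ofReal_mul (by positivity), ← ENNReal.ofReal_mul hp0.le]
      congr 1
      rw [Complex.norm_polarCoord_symm, sq_abs]
      rw [show -((1 + s) * p.1 ^ 2) = -p.1 ^ 2 + -(s * p.1 ^ 2) by ring, Real.exp_add]
      ring
    · rw [if_neg (mt hiff.1 h), if_neg h]
      simp
  have hT : polarCoord.target = Set.Ioi (0 : ℝ) ×ˢ Set.Ioo (-Real.pi) Real.pi := rfl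
  have hgp : Measurable fun p : ℝ × ℝ => g p.1 := hgm.comp measurable_fst
  have htm : MeasurableSet polarCoord.target := polarCoord.open_target.measurableSet
  rw [setLIntegral_congr_fun htm h1, hT, Measure.volume_eq_prod, ← Measure.prod_restrict,
    lintegral_prod _ hgp.aemeasurable]
  simp only [lintegral_const, Measure.restrict_apply_univ, Real.volume_Ioo]
  rw [lintegral_mul_const _ hgm]
  have h2 : ∫⁻ r in Set.Ioi (0 : ℝ), g r = ∫⁻ r in Set.Ioi (√c),
      ENNReal.ofReal (Real.pi⁻¹ * (r * Real.exp (-((1 + s) * r ^ 2)))) := by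
    rw [hg, lintegral_indicator measurableSet_Ici, Measure.restrict_restrict measurableSet_Ici]
    refine setLIntegral_congr ?_
    refine (Ioi_ae_eq_Ici.symm.inter (ae_eq_refl _)).trans ?_
    rw [Set.Ioi_inter_Ioi, sup_eq_left.2 (Real.sqrt_nonneg c)]
    exact ae_eq_refl _
  have hderiv : ∀ r : ℝ, HasDerivAt
      (fun r => -(2 * Real.pi * (1 + s))⁻¹ * Real.exp (-((1 + s) * r ^ 2)))
      (Real.pi⁻¹ * (r * Real.exp (-((1 + s) * r ^ 2)))) r := by
    intro r
    have hq : HasDerivAt (fun r : ℝ => -((1 + s) * r ^ 2)) (-((1 + s) * (2 * r))) r := by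
      simpa using ((hasDerivAt_pow 2 r).const_mul (1 + s)).fun_neg
    refine (hq.exp.const_mul (-(2 * Real.pi * (1 + s))⁻¹)).congr_deriv ?_
    have : (1 + s) ≠ 0 := by positivity
    have := Real.pi_ne_zero
    field_simp
  have hlim : Tendsto (fun r : ℝ => -(2 * Real.pi * (1 + s))⁻¹ * Real.exp (-((1 + s) * r ^ 2)))
      atTop (𝓝 0) := by
    rw [← mul_zero (-(2 * Real.pi * (1 + s))⁻¹)]
    refine Tendsto.const_mul _ (Real.tendsto_exp_neg_atTop_nhds_zero.comp ?_)
    exact (tendsto_pow_atTop two_ne_zero).const_mul_atTop (by positivity)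
  have hnn : ∀ r ∈ Set.Ioi (√c), 0 ≤ Real.pi⁻¹ * (r * Real.exp (-((1 + s) * r ^ 2))) := by
    intro r hr
    have : 0 ≤ r := (Real.sqrt_nonneg c).trans (le_of_lt hr)
    positivity
  have hint := integrableOn_Ioi_deriv_of_nonneg' (fun r _ => hderiv r) hnn hlim
  have hval := integral_Ioi_of_hasDerivAt_of_nonneg' (fun r _ => hderiv r) hnn hlim
  rw [h2, ← ofReal_integral_eq_lintegral_ofReal hint
    ((ae_restrict_iff' measurableSet_Ioi).2 (ae_of_all _ hnn)), hval, ← ENNReal.ofReal_mul']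
  · congr 1
    rw [Real.sq_sqrt hc]
    have : (1 + s) ≠ 0 := by positivity
    have := Real.pi_ne_zero
    field_simp
    ring
  · linarith [Real.pi_pos]

lemma lintegral_expNeg_stdComplexNormal_of_ne_top {θ : ℝ≥0∞} (hθ : θ ≠ ⊤) :
    ∫⁻ z, expNeg (θ * ENNReal.ofReal (‖z‖ ^ 2)) ∂stdComplexNormal = (1 + θ)⁻¹ := by
  have h := lintegral_stdComplexNormal_expNeg (s := θ.toReal) ENNReal.toReal_nonneg le_rfl
  have hu : {z : ℂ | 0 ≤ ‖z‖ ^ 2} = Set.univ := by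
    ext z
    simp
  rw [hu, ENNReal.ofReal_toReal hθ] at h
  simp only [Set.indicator_univ] at h
  rw [h, mul_zero, neg_zero, Real.exp_zero, one_div, ENNReal.ofReal_inv_of_pos (by positivity),
    ENNReal.ofReal_add zero_le_one ENNReal.toReal_nonneg, ENNReal.ofReal_one,
    ENNReal.ofReal_toReal hθ]

/-- The Laplace transform of the squared modulus, including the value `0` at `θ = ∞`. -/
lemma lintegral_expNeg_stdComplexNormal (θ : ℝ≥0∞) :
    ∫⁻ z, expNeg (θ * ENNReal.ofReal (‖z‖ ^ 2)) ∂stdComplexNormal = (1 + θ)⁻¹ := by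
  by_cases hθ : θ = ⊤
  · subst hθ
    simp only [add_top, ENNReal.inv_top]
    have hb : ∀ n : ℕ, ∫⁻ z, expNeg (⊤ * ENNReal.ofReal (‖z‖ ^ 2)) ∂stdComplexNormal
        ≤ (n : ℝ≥0∞)⁻¹ := by
      intro n
      calc _ ≤ ∫⁻ z, expNeg (n * ENNReal.ofReal (‖z‖ ^ 2)) ∂stdComplexNormal :=
            lintegral_mono fun z => expNeg_antitone (by gcongr; exact le_top)
        _ = (1 + (n : ℝ≥0∞))⁻¹ :=
            lintegral_expNeg_stdComplexNormal_of_ne_top (ENNReal.natCast_ne_top n)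
        _ ≤ _ := ENNReal.inv_le_inv.2 le_add_self
    exact le_antisymm (ge_of_tendsto' ENNReal.tendsto_inv_nat_nhds_zero hb) zero_le
  · exact lintegral_expNeg_stdComplexNormal_of_ne_top hθ

lemma stdComplexNormal_le_sq_norm (c : ℝ≥0∞) :
    stdComplexNormal {z | c ≤ ENNReal.ofReal (‖z‖ ^ 2)} = expNeg c := by
  by_cases hc : c = ⊤
  · simp [hc]
  have h := lintegral_stdComplexNormal_expNeg le_rfl (c := c.toReal) ENNReal.toReal_nonneg
  have hset : {z : ℂ | c.toReal ≤ ‖z‖ ^ 2} = {z | c ≤ ENNReal.ofReal (‖z‖ ^ 2)} := by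
    ext z
    simp only [Set.mem_ofPred_eq]
    rw [ENNReal.le_ofReal_iff_toReal_le hc (by positivity)]
  rw [hset] at h
  have hm : MeasurableSet {z : ℂ | c ≤ ENNReal.ofReal (‖z‖ ^ 2)} :=
    measurableSet_le measurable_const (by fun_prop)
  have h1 : (fun z : ℂ => expNeg (ENNReal.ofReal 0 * ENNReal.ofReal (‖z‖ ^ 2))) = 1 := by
    ext z
    simp
  rw [h1, lintegral_indicator_one hm] at h
  rw [h, expNeg_eq_of_ne_top hc]
  simp

lemma charFun_stdComplexNormal (t : ℂ) :
    charFun stdComplexNormal t = Complex.exp (-(‖t‖ ^ 2 / 4 : ℝ)) := by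
  have hm : Measurable fun p : ℝ × ℝ => (⟨p.1, p.2⟩ : ℂ) :=
    Complex.measurableEquivRealProd.symm.measurable
  have e : ∀ p : ℝ × ℝ, Complex.exp ((inner ℝ (⟨p.1, p.2⟩ : ℂ) t : ℝ) * Complex.I) =
      Complex.exp (t.re * p.1 * Complex.I) * Complex.exp (t.im * p.2 * Complex.I) := by
    intro p
    rw [← Complex.exp_add, Complex.inner]
    congr 1
    simp
    ring
  rw [charFun_apply, stdComplexNormal, integral_map hm.aemeasurable (by fun_prop)]
  simp_rw [e]
  rw [integral_prod_mul (fun x : ℝ => Complex.exp (t.re * x * Complex.I))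
    (fun y : ℝ => Complex.exp (t.im * y * Complex.I)), ← charFun_apply_real, ← charFun_apply_real,
    charFun_gaussianReal, charFun_gaussianReal, ← Complex.exp_add]
  congr 1
  rw [Complex.sq_norm, Complex.normSq_apply]
  push_cast
  ring

lemma prod_charFun_stdComplexNormal {ι : Type*} [Fintype ι] (t : EuclideanSpace ℂ ι) :
    ∏ i, charFun stdComplexNormal (t i) = Complex.exp (-(‖t‖ ^ 2 / 4 : ℝ)) := by
  simp_rw [charFun_stdComplexNormal]
  rw [← Complex.exp_sum, EuclideanSpace.norm_sq_eq, Finset.sum_div]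
  congr 1
  push_cast
  rw [Finset.sum_neg_distrib]

/-- The law of a vector of i.i.d. standard complex Gaussians is invariant under isometries. -/
lemma map_linearIsometryEquiv_pi_stdComplexNormal {ι κ : Type*} [Fintype ι] [Fintype κ]
    (U : EuclideanSpace ℂ ι ≃ₗᵢ[ℂ] EuclideanSpace ℂ κ) :
    (Measure.pi fun _ : ι => stdComplexNormal).map
      (fun h => (U (WithLp.toLp 2 h)).ofLp) = Measure.pi fun _ : κ => stdComplexNormal := by
  have hm : Measurable fun h : ι → ℂ => (U (WithLp.toLp 2 h)).ofLp := by
    have : Continuous fun h : ι → ℂ => (U (WithLp.toLp 2 h)).ofLp := by fun_prop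
    exact this.measurable
  have := Measure.isProbabilityMeasure_map
    (μ := Measure.pi fun _ : ι => stdComplexNormal) hm.aemeasurable
  rw [← charFun_eq_pi_iff]
  intro t
  have hadj : ∀ h, (inner ℝ (U h) t : ℝ) = inner ℝ h (U.symm t) := by
    intro h
    have : (inner ℂ (U h) t : ℂ) = inner ℂ h (U.symm t) := by
      rw [← U.inner_map_map h (U.symm t), U.apply_symm_apply]
    rw [PiLp.inner_apply, PiLp.inner_apply] at *
    have h2 := congrArg Complex.re this
    rw [Complex.re_sum, Complex.re_sum] at h2
    exact h2
  have h1 : charFun (((Measure.pi fun _ : ι => stdComplexNormal).map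
      (fun h => (U (WithLp.toLp 2 h)).ofLp)).map (WithLp.toLp 2)) t =
      charFun ((Measure.pi fun _ : ι => stdComplexNormal).map (WithLp.toLp 2)) (U.symm t) := by
    rw [Measure.map_map (by fun_prop) hm, charFun_apply, charFun_apply,
      integral_map (by fun_prop) (by fun_prop), integral_map (by fun_prop) (by fun_prop)]
    refine integral_congr_ae (ae_of_all _ fun h => ?_)
    simp only [Function.comp_apply, WithLp.toLp_ofLp]
    rw [hadj]
  rw [h1, charFun_pi, prod_charFun_stdComplexNormal, prod_charFun_stdComplexNormal,
    U.symm.norm_map]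

/-- The coordinates of a standard complex Gaussian vector along any orthonormal basis are i.i.d.
standard complex Gaussians. The pairing is bilinear, so it is the inner product with the conjugates
of the basis vectors. -/
lemma map_orthonormal_pi_stdComplexNormal {ι κ : Type*} [Fintype ι] [Fintype κ] [DecidableEq κ]
    (hcard : Fintype.card κ = Fintype.card ι) (u : κ → ι → ℂ)
    (hu : ∀ a b, ∑ i, star (u a i) * u b i = if a = b then 1 else 0) :
    (Measure.pi fun _ : ι => stdComplexNormal).map (fun h a => ∑ i, h i * u a i) =
      Measure.pi fun _ : κ => stdComplexNormal := by
  set v : κ → EuclideanSpace ℂ ι := fun a => WithLp.toLp 2 fun i => star (u a i) with hv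
  have ho : Orthonormal ℂ v := by
    rw [orthonormal_iff_ite]
    intro a b
    rw [PiLp.inner_apply]
    have h1 := hu b a
    simp only [eq_comm (a := b)] at h1
    rw [← h1]
    refine Finset.sum_congr rfl fun i _ => ?_
    simp [hv, RCLike.inner_apply]
  have hspan : ⊤ ≤ Submodule.span ℂ (Set.range v) := by
    have hb := ho.linearIndependent.span_eq_top_of_card_eq_finrank' (by
      rw [hcard, finrank_euclideanSpace])
    exact hb.ge
  have key := map_linearIsometryEquiv_pi_stdComplexNormal (OrthonormalBasis.mk ho hspan).repr
  rw [← key]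
  congr 1
  ext h a
  rw [OrthonormalBasis.repr_apply_apply, OrthonormalBasis.coe_mk, PiLp.inner_apply]
  refine Finset.sum_congr rfl fun i _ => ?_
  simp [hv, RCLike.inner_apply]

/-- The projections of a Rayleigh fading vector onto the beamforming direction and onto the
artificial-noise directions are i.i.d. standard complex Gaussians. -/
lemma map_rayleighLaw_prodMk {M : ℕ} (hM : 1 ≤ M) {w : Fin M → ℂ} {W : Fin M → Fin (M - 1) → ℂ}
    (hw : ∑ i, star (w i) * w i = 1)
    (hW : ∀ l l', ∑ i, star (W i l) * W i l' = if l = l' then 1 else 0)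
    (hwW : ∀ l, ∑ i, star (w i) * W i l = 0) :
    (rayleighLaw M).map (fun h => ((fun l => ∑ i, h i * W i l), ∑ i, h i * w i)) =
      (Measure.pi fun _ : Fin (M - 1) => stdComplexNormal).prod stdComplexNormal := by
  -- `none` labels the beamforming direction, `some l` the artificial-noise directions
  set u : Option (Fin (M - 1)) → Fin M → ℂ := fun a i => a.elim (w i) (W i) with hu
  have key := map_orthonormal_pi_stdComplexNormal (κ := Option (Fin (M - 1))) (ι := Fin M)
    (by simp; omega) u (by
      intro a b
      cases a with
      | none =>
        cases b with
        | none => simpa [hu] using hw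
        | some l => simpa [hu] using hwW l
      | some l =>
        cases b with
        | none =>
          have h1 := congrArg star (hwW l)
          rw [star_sum] at h1
          simpa [hu, mul_comm] using h1
        | some l' => simpa [hu] using hW l l')
  have h2 := Measure.pi_map_piOptionEquivProd (fun _ : Option (Fin (M - 1)) => stdComplexNormal)
  set e := MeasurableEquiv.piOptionEquivProd fun _ : Option (Fin (M - 1)) => ℂ
  have h3 := congrArg (Measure.map e) h2
  rw [Measure.map_map e.measurable e.symm.measurable, MeasurableEquiv.self_comp_symm,
    Measure.map_id] at h3
  rw [h3, ← key, Measure.map_map e.measurable (by fun_prop)]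
  rfl

lemma lintegral_pi_expNeg_sum_sq_norm (n : ℕ) (θ : ℝ≥0∞) :
    ∫⁻ g, expNeg (θ * ENNReal.ofReal (∑ l, ‖g l‖ ^ 2))
      ∂(Measure.pi fun _ : Fin n => stdComplexNormal) = ((1 + θ)⁻¹) ^ n := by
  have h1 : ∀ g : Fin n → ℂ, expNeg (θ * ENNReal.ofReal (∑ l, ‖g l‖ ^ 2)) =
      ∏ l, expNeg (θ * ENNReal.ofReal (‖g l‖ ^ 2)) := by
    intro g
    rw [← expNeg_sum, ENNReal.ofReal_sum_of_nonneg (fun i _ => by positivity), Finset.mul_sum]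
  simp_rw [h1]
  have hm : Measurable fun z : ℂ => expNeg (θ * ENNReal.ofReal (‖z‖ ^ 2)) :=
    measurable_expNeg.comp (by fun_prop)
  have hi : iIndepFun (fun l (g : Fin n → ℂ) => expNeg (θ * ENNReal.ofReal (‖g l‖ ^ 2)))
      (Measure.pi fun _ : Fin n => stdComplexNormal) :=
    iIndepFun_pi fun _ => hm.aemeasurable
  rw [lintegral_prod_eq_prod_lintegral_of_indepFun _ _ hi
    fun l => hm.comp (measurable_pi_apply l)]
  have h2 : ∀ l : Fin n, ∫⁻ g, expNeg (θ * ENNReal.ofReal (‖g l‖ ^ 2))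
      ∂(Measure.pi fun _ : Fin n => stdComplexNormal) = (1 + θ)⁻¹ := by
    intro l
    rw [← lintegral_expNeg_stdComplexNormal]
    exact (measurePreserving_eval (fun _ : Fin n => stdComplexNormal) l).lintegral_comp hm
  rw [Finset.prod_congr rfl fun l _ => h2 l]
  simp

/-- The Laplace transform of the artificial-noise gain, a gamma variable of shape `M - 1`. -/
lemma lintegral_rayleighLaw_expNeg_noise {M : ℕ} (hM : 1 ≤ M) {w : Fin M → ℂ}
    {W : Fin M → Fin (M - 1) → ℂ} (hw : ∑ i, star (w i) * w i = 1)
    (hW : ∀ l l', ∑ i, star (W i l) * W i l' = if l = l' then 1 else 0)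
    (hwW : ∀ l, ∑ i, star (w i) * W i l = 0) (θ : ℝ≥0∞) :
    ∫⁻ h, expNeg (θ * ENNReal.ofReal (∑ l, ‖∑ i, h i * W i l‖ ^ 2)) ∂(rayleighLaw M) =
      ((1 + θ)⁻¹) ^ (M - 1) := by
  have hF : Measurable fun p : (Fin (M - 1) → ℂ) × ℂ =>
      expNeg (θ * ENNReal.ofReal (∑ l, ‖p.1 l‖ ^ 2)) := measurable_expNeg.comp (by fun_prop)
  have h1 := congrArg (fun ν => ∫⁻ p, expNeg (θ * ENNReal.ofReal (∑ l, ‖p.1 l‖ ^ 2)) ∂ν)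
    (map_rayleighLaw_prodMk hM hw hW hwW)
  rw [lintegral_map hF (by fun_prop), lintegral_prod _ hF.aemeasurable] at h1
  simpa [lintegral_pi_expNeg_sum_sq_norm] using h1

/-- The probability that the signal gain exceeds a level proportional to the noise gain plus a
constant. -/
lemma rayleighLaw_noise_add_le_signal {M : ℕ} (hM : 1 ≤ M) {w : Fin M → ℂ}
    {W : Fin M → Fin (M - 1) → ℂ} (hw : ∑ i, star (w i) * w i = 1)
    (hW : ∀ l l', ∑ i, star (W i l) * W i l' = if l = l' then 1 else 0)
    (hwW : ∀ l, ∑ i, star (w i) * W i l = 0) {θ : ℝ≥0∞} (c : ℝ≥0∞) :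
    rayleighLaw M {h | θ * ENNReal.ofReal (∑ l, ‖∑ i, h i * W i l‖ ^ 2) + c ≤
      ENNReal.ofReal (‖∑ i, h i * w i‖ ^ 2)} = ((1 + θ)⁻¹) ^ (M - 1) * expNeg c := by
  have hS : MeasurableSet {p : (Fin (M - 1) → ℂ) × ℂ |
      θ * ENNReal.ofReal (∑ l, ‖p.1 l‖ ^ 2) + c ≤ ENNReal.ofReal (‖p.2‖ ^ 2)} :=
    measurableSet_le (by fun_prop) (by fun_prop)
  have h1 := congrArg (fun ν => ν {p : (Fin (M - 1) → ℂ) × ℂ |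
      θ * ENNReal.ofReal (∑ l, ‖p.1 l‖ ^ 2) + c ≤ ENNReal.ofReal (‖p.2‖ ^ 2)})
    (map_rayleighLaw_prodMk hM hw hW hwW)
  rw [Measure.map_apply (by fun_prop) hS, Measure.prod_apply hS] at h1
  have h2 : ∀ g : Fin (M - 1) → ℂ, stdComplexNormal (Prod.mk g ⁻¹' {p : (Fin (M - 1) → ℂ) × ℂ |
      θ * ENNReal.ofReal (∑ l, ‖p.1 l‖ ^ 2) + c ≤ ENNReal.ofReal (‖p.2‖ ^ 2)}) =
      expNeg (θ * ENNReal.ofReal (∑ l, ‖g l‖ ^ 2)) * expNeg c := by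
    intro g
    rw [← expNeg_add, ← stdComplexNormal_le_sq_norm]
    rfl
  simp_rw [h2] at h1
  have hm : Measurable fun g : Fin (M - 1) → ℂ =>
      expNeg (θ * ENNReal.ofReal (∑ l, ‖g l‖ ^ 2)) := measurable_expNeg.comp (by fun_prop)
  rw [lintegral_mul_const _ hm, lintegral_pi_expNeg_sum_sq_norm] at h1
  exact h1

/-! ### Radial integrals over the plane -/

lemma lintegral_exp_neg_Ioi (a : ℝ) :
    ∫⁻ s in Set.Ioi a, ENNReal.ofReal (Real.exp (-s)) = ENNReal.ofReal (Real.exp (-a)) := by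
  rw [← integral_exp_neg_Ioi, ofReal_integral_eq_lintegral_ofReal (integrableOn_exp_neg_Ioi a)
    (ae_of_all _ fun s => (Real.exp_pos _).le)]

/-- Layer-cake representation: `1 - exp (-t)` is the probability that an exponential variable of
rate one is at most `t`. -/
lemma one_sub_expNeg (t : ℝ≥0∞) :
    1 - expNeg t = ∫⁻ s in Set.Ioi (0 : ℝ),
      ENNReal.ofReal (Real.exp (-s)) * {s : ℝ | ENNReal.ofReal s ≤ t}.indicator 1 s := by
  by_cases ht : t = ⊤
  · subst ht
    simp [lintegral_exp_neg_Ioi]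
  have hm : MeasurableSet {s : ℝ | ENNReal.ofReal s ≤ t} :=
    measurableSet_le (by fun_prop) measurable_const
  have h0 : (0 : ℝ) ≤ t.toReal := ENNReal.toReal_nonneg
  have h1 : ∫⁻ s in Set.Ioi (0 : ℝ),
      ENNReal.ofReal (Real.exp (-s)) * {s : ℝ | ENNReal.ofReal s ≤ t}.indicator 1 s =
      ∫⁻ s in Set.Ioc 0 t.toReal, ENNReal.ofReal (Real.exp (-s)) := by
    have : ∀ s : ℝ, ENNReal.ofReal (Real.exp (-s)) * {s : ℝ | ENNReal.ofReal s ≤ t}.indicator 1 s =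
        {s : ℝ | ENNReal.ofReal s ≤ t}.indicator (fun s => ENNReal.ofReal (Real.exp (-s))) s := by
      intro s
      by_cases hs : ENNReal.ofReal s ≤ t <;> simp [hs]
    simp_rw [this]
    rw [lintegral_indicator hm, Measure.restrict_restrict hm]
    congr 2
    ext s
    simp only [Set.mem_inter_iff, Set.mem_ofPred_eq, Set.mem_Ioi, Set.mem_Ioc,
      ENNReal.ofReal_le_iff_le_toReal ht]
    tauto
  have h2 : ∫⁻ s in Set.Ioi (0 : ℝ), ENNReal.ofReal (Real.exp (-s)) =
      (∫⁻ s in Set.Ioc 0 t.toReal, ENNReal.ofReal (Real.exp (-s))) +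
      ∫⁻ s in Set.Ioi t.toReal, ENNReal.ofReal (Real.exp (-s)) := by
    rw [← lintegral_union measurableSet_Ioi
      (Set.disjoint_left.2 fun s hs hs' => not_lt.2 hs.2 hs'), Set.Ioc_union_Ioi_eq_Ioi h0]
  rw [lintegral_exp_neg_Ioi, lintegral_exp_neg_Ioi, ← expNeg_eq_of_ne_top ht, neg_zero,
    Real.exp_zero, ENNReal.ofReal_one] at h2
  rw [h1, h2, ENNReal.add_sub_cancel_right (expNeg_ne_top t)]

lemma measurable_pathGain {β : Type*} [MeasurableSpace β] {α : ℝ} {f g : β → Plane}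
    (hf : Measurable f) (hg : Measurable g) : Measurable fun x => pathGain α (f x) (g x) := by
  unfold pathGain
  exact ((hf.dist hg).ennreal_ofReal).pow_const _

lemma pathGain_of_ne {α : ℝ} {x y : Plane} (h : x ≠ y) :
    pathGain α x y = ENNReal.ofReal (dist x y ^ (-α)) :=
  ENNReal.ofReal_rpow_of_pos (dist_pos.2 h)

lemma pathGain_self {α : ℝ} (hα : 0 < α) (x : Plane) : pathGain α x x = ⊤ := by
  simp [pathGain, hα]

/-- The points whose gain, scaled by `c`, is at least `s` form a disc of radius `(c / s) ^ (1 / α)`,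
which contains its centre because the gain is infinite there. -/
lemma volume_le_mul_pathGain {α c s : ℝ} (hα : 0 < α) (hc : 0 ≤ c) (hs : 0 < s) (x : Plane) :
    volume {y | ENNReal.ofReal s ≤ ENNReal.ofReal c * pathGain α y x} =
      ENNReal.ofReal (Real.pi * (c / s) ^ (2 / α)) := by
  rcases hc.eq_or_lt with rfl | hc
  · simp [Real.zero_rpow (div_pos two_pos hα).ne', not_le.2 hs]
  have hset : {y | ENNReal.ofReal s ≤ ENNReal.ofReal c * pathGain α y x} =
      Metric.closedBall x ((c / s) ^ (1 / α)) := by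
    ext y
    simp only [Set.mem_ofPred_eq, Metric.mem_closedBall]
    by_cases hyx : y = x
    · subst hyx
      rw [pathGain_self hα, ENNReal.mul_top (by simpa using hc)]
      simp only [le_top, dist_self, true_iff]
      positivity
    · have hd : 0 < dist y x := dist_pos.2 hyx
      rw [pathGain_of_ne hyx, ← ENNReal.ofReal_mul hc.le, ENNReal.ofReal_le_ofReal_iff
        (by positivity), Real.rpow_neg hd.le, ← div_eq_mul_inv, le_div_iff₀ (by positivity),
        mul_comm, ← le_div_iff₀ hs]
      rw [one_div, Real.le_rpow_inv_iff_of_pos hd.le (by positivity) hα]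
  rw [hset, EuclideanSpace.volume_closedBall_fin_two, ← ENNReal.ofReal_pow (by positivity),
    ← ENNReal.ofReal_mul (by positivity)]
  congr 1
  rw [← Real.rpow_natCast, ← Real.rpow_mul (by positivity)]
  rw [mul_comm]
  congr 2
  push_cast
  ring

/-- The layer-cake representation turns the area integral into a gamma integral, convergent at `0`
because `α > 2`. -/
lemma lintegral_one_sub_expNeg_mul_pathGain {α c : ℝ} (hα : 2 < α) (hc : 0 ≤ c) (x : Plane) :
    ∫⁻ y, (1 - expNeg (ENNReal.ofReal c * pathGain α y x)) =
      ENNReal.ofReal (Real.pi * c ^ (2 / α) * Real.Gamma (1 - 2 / α)) := by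
  have hα0 : 0 < α := by linarith
  have hδ : 2 / α < 1 := by rw [div_lt_one hα0]; exact hα
  have hpm : Measurable fun y => pathGain α y x :=
    measurable_pathGain measurable_id measurable_const
  simp_rw [one_sub_expNeg]
  have hset : MeasurableSet {p : Plane × ℝ | ENNReal.ofReal p.2 ≤
      ENNReal.ofReal c * pathGain α p.1 x} :=
    measurableSet_le (by fun_prop) ((hpm.comp measurable_fst).const_mul _)
  have hmeas : Measurable fun p : Plane × ℝ => ENNReal.ofReal (Real.exp (-p.2)) *
      {s : ℝ | ENNReal.ofReal s ≤ ENNReal.ofReal c * pathGain α p.1 x}.indicator 1 p.2 := by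
    refine Measurable.mul (by fun_prop) ?_
    exact (measurable_one.indicator hset : Measurable ({p : Plane × ℝ | ENNReal.ofReal p.2 ≤
      ENNReal.ofReal c * pathGain α p.1 x}.indicator (1 : Plane × ℝ → ℝ≥0∞)))
  rw [lintegral_lintegral_swap hmeas.aemeasurable]
  have h1 : ∀ s ∈ Set.Ioi (0 : ℝ), ∫⁻ y, ENNReal.ofReal (Real.exp (-s)) *
      {s : ℝ | ENNReal.ofReal s ≤ ENNReal.ofReal c * pathGain α y x}.indicator 1 s =
      ENNReal.ofReal (Real.pi * c ^ (2 / α) * (Real.exp (-s) * s ^ ((1 - 2 / α) - 1))) := by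
    intro s hs
    have hs' : 0 < s := hs
    have hm : MeasurableSet {y | ENNReal.ofReal s ≤ ENNReal.ofReal c * pathGain α y x} :=
      measurableSet_le measurable_const (hpm.const_mul _)
    rw [lintegral_const_mul' _ _ ENNReal.ofReal_ne_top]
    have : ∀ y, {s : ℝ | ENNReal.ofReal s ≤ ENNReal.ofReal c * pathGain α y x}.indicator
        (1 : ℝ → ℝ≥0∞) s =
        {y | ENNReal.ofReal s ≤ ENNReal.ofReal c * pathGain α y x}.indicator 1 y := fun y => rfl
    simp_rw [this]
    rw [lintegral_indicator_one hm, volume_le_mul_pathGain hα0 hc hs',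
      ← ENNReal.ofReal_mul (by positivity)]
    congr 1
    rw [Real.div_rpow hc hs'.le, show (1 - 2 / α) - 1 = -(2 / α) by ring, Real.rpow_neg hs'.le]
    ring
  rw [setLIntegral_congr_fun measurableSet_Ioi h1]
  have hint := Real.GammaIntegral_convergent (s := 1 - 2 / α) (by linarith)
  rw [← ofReal_integral_eq_lintegral_ofReal (hint.const_mul _), integral_const_mul,
    Real.Gamma_eq_integral (by linarith)]
  refine (ae_restrict_iff' measurableSet_Ioi).2 (ae_of_all _ fun s hs => ?_)
  have hs' : 0 < s := hs
  positivity

/-- The Laplace transform `(1 + θ)⁻ⁿ` as a mixture over the gamma density of shape `n`. -/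
lemma lintegral_gamma_expNeg {n : ℕ} (hn : 1 ≤ n) (θ : ℝ≥0∞) :
    ∫⁻ t in Set.Ioi (0 : ℝ), ENNReal.ofReal ((Real.Gamma n)⁻¹ * (t ^ ((n : ℝ) - 1) * Real.exp (-t)))
      * expNeg (θ * ENNReal.ofReal t) = ((1 + θ)⁻¹) ^ n := by
  have hn0 : (0 : ℝ) < n := by exact_mod_cast hn
  by_cases hθ : θ = ⊤
  · subst hθ
    rw [setLIntegral_congr_fun measurableSet_Ioi (g := 0)]
    · have : n ≠ 0 := by omega
      simp [this]
    · intro t ht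
      have : (0 : ℝ) < t := ht
      simp [ENNReal.top_mul, this]
  set r : ℝ := 1 + θ.toReal with hr
  have hr0 : 0 < r := by positivity
  have hG := Real.Gamma_pos_of_pos hn0
  have h1 : ∀ t ∈ Set.Ioi (0 : ℝ),
      ENNReal.ofReal ((Real.Gamma n)⁻¹ * (t ^ ((n : ℝ) - 1) * Real.exp (-t)))
        * expNeg (θ * ENNReal.ofReal t) =
      ENNReal.ofReal ((Real.Gamma n)⁻¹ * (t ^ ((n : ℝ) - 1) * Real.exp (-(r * t)))) := by
    intro t ht
    have ht' : (0 : ℝ) < t := ht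
    rw [← ENNReal.ofReal_toReal hθ, ← ENNReal.ofReal_mul ENNReal.toReal_nonneg,
      expNeg_ofReal (by positivity), ← ENNReal.ofReal_mul (by positivity)]
    congr 1
    rw [hr, show -((1 + θ.toReal) * t) = -t + -(θ.toReal * t) by ring, Real.exp_add]
    ring
  rw [setLIntegral_congr_fun measurableSet_Ioi h1]
  have hval := Real.integral_rpow_mul_exp_neg_mul_Ioi hn0 hr0
  have hint : IntegrableOn (fun t : ℝ => t ^ ((n : ℝ) - 1) * Real.exp (-(r * t))) (Set.Ioi 0) := by
    refine Integrable.of_integral_ne_zero ?_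
    rw [hval]
    positivity
  rw [← ofReal_integral_eq_lintegral_ofReal (hint.const_mul _), integral_const_mul, hval]
  · rw [← ENNReal.ofReal_toReal hθ, ← ENNReal.ofReal_one,
      ← ENNReal.ofReal_add zero_le_one ENNReal.toReal_nonneg, ← hr,
      ← ENNReal.ofReal_inv_of_pos hr0, ← ENNReal.ofReal_pow (by positivity)]
    congr 1
    rw [Real.rpow_natCast]
    field_simp
  · refine (ae_restrict_iff' measurableSet_Ioi).2 (ae_of_all _ fun s hs => ?_)
    have hs' : 0 < s := hs
    positivity

/-- The area integral behind the interference functional: gamma-distributed noise gains with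
path loss `r ↦ a r ^ (-α)`. -/
lemma lintegral_one_sub_inv_one_add_pathGain_pow {α a : ℝ} (hα : 2 < α) (ha : 0 ≤ a) {n : ℕ}
    (hn : 1 ≤ n) (x : Plane) :
    ∫⁻ y, (1 - ((1 + ENNReal.ofReal a * pathGain α y x)⁻¹) ^ n) =
      ENNReal.ofReal (Real.pi * a ^ (2 / α) *
        (Real.Gamma (n + 2 / α) * Real.Gamma (1 - 2 / α) / Real.Gamma n)) := by
  have hn0 : (0 : ℝ) < n := by exact_mod_cast hn
  have hα0 : 0 < α := by linarith
  have hδ0 : 0 < 2 / α := by positivity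
  have hδ : 2 / α < 1 := by rw [div_lt_one hα0]; exact hα
  have hG := Real.Gamma_pos_of_pos hn0
  have hG1 : 0 < Real.Gamma (1 - 2 / α) := Real.Gamma_pos_of_pos (by linarith)
  have hpm : Measurable fun y => pathGain α y x :=
    measurable_pathGain measurable_id measurable_const
  set p : ℝ → ℝ≥0∞ := fun t =>
    ENNReal.ofReal ((Real.Gamma n)⁻¹ * (t ^ ((n : ℝ) - 1) * Real.exp (-t))) with hp
  have hpmeas : Measurable p := by rw [hp]; fun_prop
  have htot : ∫⁻ t in Set.Ioi (0 : ℝ), p t = 1 := by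
    have := lintegral_gamma_expNeg hn 0
    simpa using this
  have hmix : ∀ θ : ℝ≥0∞, 1 - ((1 + θ)⁻¹) ^ n =
      ∫⁻ t in Set.Ioi (0 : ℝ), p t * (1 - expNeg (θ * ENNReal.ofReal t)) := by
    intro θ
    refine ENNReal.sub_eq_of_eq_add (ENNReal.pow_ne_top (by simp)) ?_
    · rw [← lintegral_gamma_expNeg hn]
      have hm : Measurable fun t : ℝ => p t * (1 - expNeg (θ * ENNReal.ofReal t)) :=
        hpmeas.mul (measurable_const.sub (measurable_expNeg.comp (by fun_prop)))
      rw [← lintegral_add_left hm]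
      refine htot.symm.trans (lintegral_congr fun t => ?_)
      rw [← mul_add, tsub_add_cancel_of_le (expNeg_le_one _), mul_one]
  simp_rw [hmix]
  have hmeas : Measurable fun q : Plane × ℝ => p q.2 *
      (1 - expNeg (ENNReal.ofReal a * pathGain α q.1 x * ENNReal.ofReal q.2)) := by
    refine (hpmeas.comp measurable_snd).mul (measurable_const.sub (measurable_expNeg.comp ?_))
    exact ((hpm.comp measurable_fst).const_mul _).mul (by fun_prop)
  rw [lintegral_lintegral_swap hmeas.aemeasurable]
  have h1 : ∀ t ∈ Set.Ioi (0 : ℝ), ∫⁻ y, p t *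
      (1 - expNeg (ENNReal.ofReal a * pathGain α y x * ENNReal.ofReal t)) =
      ENNReal.ofReal (Real.pi * a ^ (2 / α) * Real.Gamma (1 - 2 / α) * (Real.Gamma n)⁻¹ *
        (Real.exp (-t) * t ^ ((n + 2 / α) - 1))) := by
    intro t ht
    have ht' : (0 : ℝ) < t := ht
    rw [lintegral_const_mul' _ _ ENNReal.ofReal_ne_top]
    have e : ∀ y, ENNReal.ofReal a * pathGain α y x * ENNReal.ofReal t =
        ENNReal.ofReal (a * t) * pathGain α y x := by
      intro y
      rw [ENNReal.ofReal_mul ha]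
      ring
    simp_rw [e]
    rw [lintegral_one_sub_expNeg_mul_pathGain hα (by positivity),
      ← ENNReal.ofReal_mul (by positivity)]
    congr 1
    rw [Real.mul_rpow ha ht'.le, show (n : ℝ) + 2 / α - 1 = (n - 1) + 2 / α by ring,
      Real.rpow_add ht']
    ring
  rw [setLIntegral_congr_fun measurableSet_Ioi h1]
  have hint := Real.GammaIntegral_convergent (s := n + 2 / α) (by linarith)
  rw [← ofReal_integral_eq_lintegral_ofReal (hint.const_mul _), integral_const_mul,
    ← Real.Gamma_eq_integral (by linarith)]
  · congr 1
    ring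
  · refine (ae_restrict_iff' measurableSet_Ioi).2 (ae_of_all _ fun s hs => ?_)
    have hs' : 0 < s := hs
    positivity

lemma lintegral_exp_neg_mul_sq_dist {c : ℝ} (hc : 0 < c) (b : Plane) :
    ∫⁻ x : Plane, ENNReal.ofReal (Real.exp (-(c * dist x b ^ 2))) =
      ENNReal.ofReal (Real.pi / c) := by
  have hval : ∫ x : Plane, Real.exp (-(c * ‖x‖ ^ 2)) = Real.pi / c := by
    have := GaussianFourier.integral_rexp_neg_mul_sq_norm (V := Plane) hc
    simpa [neg_mul] using this
  have hint : Integrable fun x : Plane => Real.exp (-(c * ‖x‖ ^ 2)) := by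
    refine Integrable.of_integral_ne_zero ?_
    rw [hval]
    have := Real.pi_pos
    positivity
  simp_rw [dist_eq_norm]
  rw [lintegral_sub_right_eq_self (fun x : Plane => ENNReal.ofReal (Real.exp (-(c * ‖x‖ ^ 2)))) b,
    ← ofReal_integral_eq_lintegral_ofReal hint (ae_of_all _ fun x => (Real.exp_pos _).le), hval]

/-- The squared distance from `b` to the nearest point of a Poisson process of density `lam` is
exponential of rate `π lam`; this is its Laplace transform. -/
lemma IsPoissonProcess.lintegral_one_sub_expNeg_iInf_sq_dist {Ω : Type*} [MeasurableSpace Ω]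
    {μ : Measure Ω} [IsProbabilityMeasure μ] {X : ℕ → Ω → Plane} {lam : ℝ}
    (h : IsPoissonProcess μ X lam) (hlam : 0 < lam) (b : Plane) {c : ℝ} (hc : 0 ≤ c) :
    ∫⁻ ω, (1 - expNeg (⨅ n, ENNReal.ofReal (c * dist (X n ω) b ^ 2))) ∂μ =
      ENNReal.ofReal (c / (c + lam * Real.pi)) := by
  rcases hc.eq_or_lt with rfl | hc
  · simp
  have hpi := Real.pi_pos
  have hdm : ∀ n, Measurable fun ω => ENNReal.ofReal (c * dist (X n ω) b ^ 2) := fun n => by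
    have := (h.measurable n).dist (measurable_const (a := b))
    fun_prop
  have hRm : Measurable fun ω => ⨅ n, ENNReal.ofReal (c * dist (X n ω) b ^ 2) :=
    Measurable.iInf hdm
  simp_rw [one_sub_expNeg]
  have hset : MeasurableSet {p : Ω × ℝ | ENNReal.ofReal p.2 ≤
      ⨅ n, ENNReal.ofReal (c * dist (X n p.1) b ^ 2)} :=
    measurableSet_le (by fun_prop) (hRm.comp measurable_fst)
  have hmeas : Measurable fun p : Ω × ℝ => ENNReal.ofReal (Real.exp (-p.2)) *
      {s : ℝ | ENNReal.ofReal s ≤ ⨅ n, ENNReal.ofReal (c * dist (X n p.1) b ^ 2)}.indicator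
        1 p.2 := by
    refine Measurable.mul (by fun_prop) ?_
    exact (measurable_one.indicator hset : Measurable ({p : Ω × ℝ | ENNReal.ofReal p.2 ≤
      ⨅ n, ENNReal.ofReal (c * dist (X n p.1) b ^ 2)}.indicator (1 : Ω × ℝ → ℝ≥0∞)))
  rw [lintegral_lintegral_swap hmeas.aemeasurable]
  have h1 : ∀ s ∈ Set.Ioi (0 : ℝ), ∫⁻ ω, ENNReal.ofReal (Real.exp (-s)) *
      {s : ℝ | ENNReal.ofReal s ≤ ⨅ n, ENNReal.ofReal (c * dist (X n ω) b ^ 2)}.indicator 1 s ∂μ =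
      ENNReal.ofReal (Real.exp (-(1 + lam * Real.pi / c) * s)) := by
    intro s hs
    have hs' : (0 : ℝ) < s := hs
    have hm : MeasurableSet {ω | ENNReal.ofReal s ≤ ⨅ n, ENNReal.ofReal (c * dist (X n ω) b ^ 2)} :=
      measurableSet_le measurable_const hRm
    rw [lintegral_const_mul' _ _ ENNReal.ofReal_ne_top]
    have e : ∀ ω, {s : ℝ | ENNReal.ofReal s ≤
        ⨅ n, ENNReal.ofReal (c * dist (X n ω) b ^ 2)}.indicator (1 : ℝ → ℝ≥0∞) s =
        {ω | ENNReal.ofReal s ≤ ⨅ n, ENNReal.ofReal (c * dist (X n ω) b ^ 2)}.indicator 1 ω :=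
      fun ω => rfl
    simp_rw [e]
    have hball : {ω | ENNReal.ofReal s ≤ ⨅ n, ENNReal.ofReal (c * dist (X n ω) b ^ 2)} =
        {ω | ∀ n, X n ω ∉ Metric.ball b √(s / c)} := by
      ext ω
      simp only [Set.mem_ofPred_eq, le_iInf_iff, Metric.mem_ball, not_lt]
      refine forall_congr' fun n => ?_
      rw [ENNReal.ofReal_le_ofReal_iff (by positivity), Real.sqrt_le_left dist_nonneg,
        div_le_iff₀' hc]
    rw [lintegral_indicator_one hm, hball, h.measure_forall_notMem measurableSet_ball,
      EuclideanSpace.volume_ball_fin_two, ← ENNReal.ofReal_pow (by positivity),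
      Real.sq_sqrt (by positivity),
      ← ENNReal.ofReal_mul (by positivity), ← ENNReal.ofReal_mul hlam.le,
      expNeg_ofReal (by positivity), ← ENNReal.ofReal_mul (by positivity), ← Real.exp_add]
    congr 2
    field_simp
    ring
  rw [setLIntegral_congr_fun measurableSet_Ioi h1]
  have hr : -(1 + lam * Real.pi / c) < 0 := by
    have : 0 < lam * Real.pi / c := by positivity
    linarith
  rw [← ofReal_integral_eq_lintegral_ofReal (integrableOn_exp_mul_Ioi hr 0)
    (ae_of_all _ fun s => (Real.exp_pos _).le), integral_exp_mul_Ioi hr]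
  congr 1
  rw [mul_zero, Real.exp_zero, neg_div_neg_eq]
  field_simp

/-! ### Channel gains at an eavesdropper -/

-- The σ-algebra is an implicit argument, not an instance: it is mostly one generated by sources.
lemma measurable_indicator_one {β : Type*} {_ : MeasurableSpace β} {s : Set β}
    (hs : MeasurableSet s) : Measurable (s.indicator (1 : β → ℝ≥0∞)) :=
  measurable_one.indicator hs

/-- The gain `|hᵀ w|²` of the information signal, where `w` is the beamforming vector matched to
the channel `u` of the served user. -/
noncomputable def signalGain {n : ℕ} (h u : Fin n → ℂ) : ℝ :=
  ‖∑ i, h i * (star (u i) / ((√(∑ l, ‖u l‖ ^ 2) : ℝ) : ℂ))‖ ^ 2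

/-- The gain `‖hᵀ W‖²` of the artificial noise. -/
noncomputable def noiseGain {n : ℕ} (h : Fin n → ℂ) (W : Fin n → Fin (n - 1) → ℂ) : ℝ :=
  ∑ l, ‖∑ i, h i * W i l‖ ^ 2

lemma measurable_signalGain {β : Type*} {n : ℕ} {_ : MeasurableSpace β} {f g : β → Fin n → ℂ}
    (hf : Measurable f) (hg : Measurable g) : Measurable fun x => signalGain (f x) (g x) := by
  unfold signalGain
  have h1 : ∀ i, Measurable fun x => f x i := fun i => (measurable_pi_apply i).comp hf
  have h2 : ∀ i, Measurable fun x => g x i := fun i => (measurable_pi_apply i).comp hg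
  have h3 : ∀ i, Measurable fun x => star (g x i) := fun i => continuous_star.measurable.comp (h2 i)
  have h4 : Measurable fun x => ((√(∑ l, ‖g x l‖ ^ 2) : ℝ) : ℂ) :=
    Complex.measurable_ofReal.comp
      (Finset.measurable_fun_sum _ fun i _ => (h2 i).norm.pow_const 2).sqrt
  exact (Finset.measurable_fun_sum _ fun i _ => (h1 i).mul ((h3 i).div h4)).norm.pow_const 2

lemma measurable_noiseGain {β : Type*} {n : ℕ} {_ : MeasurableSpace β} {f : β → Fin n → ℂ}
    {g : β → Fin n → Fin (n - 1) → ℂ} (hf : Measurable f) (hg : Measurable g) :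
    Measurable fun x => noiseGain (f x) (g x) := by
  unfold noiseGain
  have h1 : ∀ i, Measurable fun x => f x i := fun i => (measurable_pi_apply i).comp hf
  have h2 : ∀ i l, Measurable fun x => g x i l := fun i l =>
    (measurable_pi_apply l).comp ((measurable_pi_apply i).comp hg)
  exact Finset.measurable_fun_sum _ fun l _ =>
    (Finset.measurable_fun_sum _ fun i _ => (h1 i).mul (h2 i l)).norm.pow_const 2

/-- The beamforming vector is a unit vector unless the channel vanishes. -/
lemma sum_star_beam_mul_self {n : ℕ} {u : Fin n → ℂ} (hu : u ≠ 0) :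
    ∑ i, star (star (u i) / ((√(∑ l, ‖u l‖ ^ 2) : ℝ) : ℂ)) *
      (star (u i) / ((√(∑ l, ‖u l‖ ^ 2) : ℝ) : ℂ)) = 1 := by
  have hpos : 0 < ∑ l, ‖u l‖ ^ 2 := by
    obtain ⟨i, hi⟩ := Function.ne_iff.1 hu
    refine Finset.sum_pos' (fun _ _ => by positivity) ⟨i, Finset.mem_univ _, ?_⟩
    have := norm_pos_iff.2 hi
    positivity
  set s := √(∑ l, ‖u l‖ ^ 2) with hs
  have hs2 : s ^ 2 = ∑ l, ‖u l‖ ^ 2 := Real.sq_sqrt hpos.le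
  have hs0 : (s : ℂ) ≠ 0 := by
    rw [Complex.ofReal_ne_zero]
    exact (Real.sqrt_pos.2 hpos).ne'
  have e : ∀ i, star (star (u i) / (s : ℂ)) * (star (u i) / (s : ℂ)) =
      ((‖u i‖ ^ 2 : ℝ) : ℂ) / (s : ℂ) ^ 2 := by
    intro i
    have h1 : u i * star (u i) = ((‖u i‖ ^ 2 : ℝ) : ℂ) := by
      rw [Complex.star_def, Complex.mul_conj, Complex.sq_norm]
    rw [star_div₀, star_star, show star (s : ℂ) = s from Complex.conj_ofReal s,
      div_mul_div_comm, h1, ← sq (s : ℂ)]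
  rw [Finset.sum_congr rfl fun i _ => e i, ← Finset.sum_div, ← Complex.ofReal_sum, ← hs2]
  push_cast
  exact div_self (pow_ne_zero 2 hs0)

lemma ae_pos_of_measure_le_eq_expNeg {β : Type*} [MeasurableSpace β] {ν : Measure β}
    [IsProbabilityMeasure ν] {f : β → ℝ≥0∞} (hf : Measurable f)
    (h : ∀ c, ν {x | c ≤ f x} = expNeg c) : ∀ᵐ x ∂ν, 0 < f x := by
  have ht : Tendsto (fun m : ℕ => ν {x | ((m : ℝ≥0∞) + 1)⁻¹ ≤ f x}) atTop (𝓝 1) := by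
    simp_rw [h]
    rw [← expNeg_zero]
    refine (continuous_expNeg.tendsto 0).comp ?_
    have := (tendsto_add_atTop_iff_nat 1).2 ENNReal.tendsto_inv_nat_nhds_zero
    simpa using this
  have hle : ∀ m : ℕ, ν {x | ((m : ℝ≥0∞) + 1)⁻¹ ≤ f x} ≤ ν {x | 0 < f x} := fun m =>
    measure_mono fun x hx => lt_of_lt_of_le (by simp) (Set.mem_ofPred_eq ▸ hx)
  have h2 : ν {x | 0 < f x} = 1 := le_antisymm prob_le_one (le_of_tendsto' ht hle)
  exact (prob_compl_eq_zero_iff (measurableSet_lt measurable_const hf)).2 h2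

lemma rayleighLaw_singleton_zero {n : ℕ} (hn : 1 ≤ n) : rayleighLaw n {0} = 0 := by
  have h1 : stdComplexNormal {0} = 0 := by
    have := ae_pos_of_measure_le_eq_expNeg (by fun_prop) stdComplexNormal_le_sq_norm
    rw [ae_iff] at this
    convert this using 2
    ext z
    simp
  have hsub : ({0} : Set (Fin n → ℂ)) ⊆ (fun h => h ⟨0, hn⟩) ⁻¹' {0} := by
    rintro h rfl
    rfl
  refine measure_mono_null hsub ?_
  have := (measurePreserving_eval (fun _ : Fin n => stdComplexNormal) ⟨0, hn⟩).measure_preimage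
    (measurableSet_singleton (0 : ℂ)).nullMeasurableSet
  exact this.trans h1

namespace NetworkVars

variable {K : ℕ} {N : HCN K} {k : Fin K} {Ω : Type*} {V : NetworkVars N k Ω}

/-- The artificial-noise gain of base station `p` at eavesdropper `m`, or zero if `p` is idle. -/
noncomputable def activeNoiseGain (V : NetworkVars N k Ω) (m : ℕ) (p : Fin K × ℕ) (ω : Ω) : ℝ≥0∞ :=
  if V.active p.1 p.2 ω then
    ENNReal.ofReal (noiseGain (V.eveChannel (some p) m ω) (V.noiseMatrix (some p) ω))
  else 0

lemma measurable_iSup_source {β : Type*} [MeasurableSpace β] {S : Set (Source K)} {s : Source K}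
    (hs : s ∈ S) {f : Ω → β} (hf : Measurable[V.sourceSigma s] f) :
    Measurable[⨆ s ∈ S, V.sourceSigma s] f :=
  hf.mono (le_iSup₂ (f := fun s (_ : s ∈ S) => V.sourceSigma s) s hs) le_rfl

/-- The sources that determine the gain of transmitter `z` at eavesdropper `m`. -/
def gainSources (z : Transmitter K) (m : ℕ) : Set (Source K) := {.eveChannel z m, .beam z}

/-- The sources that determine the noise of base station `p` at eavesdropper `m`. -/
def noiseSources (m : ℕ) (p : Fin K × ℕ) : Set (Source K) :=
  {.active p.1 p.2, .eveChannel (some p) m, .beam (some p)}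

lemma measurable_channel (z : Transmitter K) (m : ℕ) {S : Set (Source K)}
    (hS : .eveChannel z m ∈ S) : Measurable[⨆ s ∈ S, V.sourceSigma s] (V.eveChannel z m) :=
  measurable_iSup_source hS (comap_measurable _)

lemma measurable_beamPair (z : Transmitter K) {S : Set (Source K)} (hS : .beam z ∈ S) :
    Measurable[⨆ s ∈ S, V.sourceSigma s] (fun ω => (V.ueChannel z ω, V.noiseMatrix z ω)) :=
  measurable_iSup_source hS (comap_measurable _)

lemma measurable_noiseGain_source (z : Transmitter K) (m : ℕ) {S : Set (Source K)}
    (hS : gainSources z m ⊆ S) : Measurable[⨆ s ∈ S, V.sourceSigma s]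
      (fun ω => noiseGain (V.eveChannel z m ω) (V.noiseMatrix z ω)) := by
  have h1 := measurable_channel (V := V) z m (hS (Set.mem_insert _ _))
  have h2 := measurable_beamPair (V := V) z (hS (Set.mem_insert_of_mem _ rfl))
  exact measurable_noiseGain h1 (measurable_snd.comp h2)

lemma measurable_signalGain_source (z : Transmitter K) (m : ℕ) {S : Set (Source K)}
    (hS : gainSources z m ⊆ S) : Measurable[⨆ s ∈ S, V.sourceSigma s]
      (fun ω => signalGain (V.eveChannel z m ω) (V.ueChannel z ω)) := by
  have h1 := measurable_channel (V := V) z m (hS (Set.mem_insert _ _))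
  have h2 := measurable_beamPair (V := V) z (hS (Set.mem_insert_of_mem _ rfl))
  exact measurable_signalGain h1 (measurable_fst.comp h2)

lemma measurable_active_source (p : Fin K × ℕ) {S : Set (Source K)}
    (hS : .active p.1 p.2 ∈ S) : Measurable[⨆ s ∈ S, V.sourceSigma s] (V.active p.1 p.2) :=
  measurable_iSup_source hS (comap_measurable _)

lemma measurable_activeNoiseGain (m : ℕ) (p : Fin K × ℕ) {S : Set (Source K)}
    (hS : noiseSources m p ⊆ S) :
    Measurable[⨆ s ∈ S, V.sourceSigma s] (V.activeNoiseGain m p) := by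
  have h1 := measurable_active_source (V := V) p (hS (Set.mem_insert _ _))
  have h2 := measurable_noiseGain_source (V := V) (some p) m
    ((Set.subset_insert _ _).trans hS)
  have h3 := h1 (measurableSet_singleton true)
  exact Measurable.ite (m := ⨆ s ∈ S, V.sourceSigma s) h3 h2.ennreal_ofReal measurable_const

variable [mΩ : MeasurableSpace Ω] {μ : Measure Ω} {A : Fin K → ℝ}

lemma IsNetwork.sourceSigma_le (hV : V.IsNetwork μ A) (s : Source K) : V.sourceSigma s ≤ mΩ := by
  cases s with
  | bs j => exact (measurable_pi_lambda _ fun n => (hV.bs_poisson j).measurable n).comap_le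
  | ue => exact (measurable_pi_lambda _ fun n => hV.ue_poisson.measurable n).comap_le
  | eve => exact (measurable_pi_lambda _ fun n => hV.eve_poisson.measurable n).comap_le
  | active j n => exact (hV.active_measurable j n).comap_le
  | eveChannel z m => exact (hV.eveChannel_measurable z m).comap_le
  | beam z => exact ((hV.ueChannel_measurable z).prodMk (hV.noiseMatrix_measurable z)).comap_le

lemma IsNetwork.iSup_source_le (hV : V.IsNetwork μ A) (S : Set (Source K)) :
    ⨆ s ∈ S, V.sourceSigma s ≤ mΩ := iSup₂_le fun s _ => hV.sourceSigma_le s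

lemma IsNetwork.indep_of_disjoint (hV : V.IsNetwork μ A) {S T : Set (Source K)}
    (h : Disjoint S T) : Indep (⨆ s ∈ S, V.sourceSigma s) (⨆ s ∈ T, V.sourceSigma s) μ :=
  indep_iSup_of_disjoint hV.sourceSigma_le hV.independent h

lemma IsNetwork.indepFun (hV : V.IsNetwork μ A) {β γ : Type*} [MeasurableSpace β]
    [MeasurableSpace γ] {S T : Set (Source K)} (h : Disjoint S T) {f : Ω → β} {g : Ω → γ}
    (hf : Measurable[⨆ s ∈ S, V.sourceSigma s] f) (hg : Measurable[⨆ s ∈ T, V.sourceSigma s] g) :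
    IndepFun f g μ :=
  indep_of_indep_of_le_left (indep_of_indep_of_le_right (hV.indep_of_disjoint h) hg.comap_le)
    hf.comap_le

variable [IsProbabilityMeasure μ]

/-- Averaging over the fading vector for a fixed pair of beamforming vector and artificial-noise
matrix: if the average does not depend on the (unitary) pair, it is the full average. -/
lemma IsNetwork.lintegral_gain (hV : V.IsNetwork μ A) (z : Transmitter K) (m : ℕ)
    {F : (Fin (N.antennas (tierOf k z)) → ℂ) → (Fin (N.antennas (tierOf k z)) → ℂ) ×
      (Fin (N.antennas (tierOf k z)) → Fin (N.antennas (tierOf k z) - 1) → ℂ) → ℝ≥0∞}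
    (hF : Measurable (Function.uncurry F)) {C : ℝ≥0∞}
    (hC : ∀ u W, (∑ i, star (star (u i) / ((√(∑ l, ‖u l‖ ^ 2) : ℝ) : ℂ)) *
        (star (u i) / ((√(∑ l, ‖u l‖ ^ 2) : ℝ) : ℂ)) = 1) →
      (∀ l l', ∑ i, star (W i l) * W i l' = if l = l' then 1 else 0) →
      (∀ l, ∑ i, star (star (u i) / ((√(∑ l, ‖u l‖ ^ 2) : ℝ) : ℂ)) * W i l = 0) →
      ∫⁻ h, F h (u, W) ∂(rayleighLaw (N.antennas (tierOf k z))) = C) :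
    ∫⁻ ω, F (V.eveChannel z m ω) (V.ueChannel z ω, V.noiseMatrix z ω) ∂μ = C := by
  have hB := (hV.ueChannel_measurable z).prodMk (hV.noiseMatrix_measurable z)
  have hI : IndepFun (fun ω => (V.ueChannel z ω, V.noiseMatrix z ω)) (V.eveChannel z m) μ :=
    hV.independent.indep (i := .beam z) (j := .eveChannel z m) (by simp)
  have hF' := hF.comp measurable_swap
  rw [hI.lintegral_prodMk (F := fun B h => F h B) hB (hV.eveChannel_measurable z m) hF']
  have h0 : ∀ᵐ ω ∂μ, V.ueChannel z ω ≠ 0 := by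
    have h1 := rayleighLaw_singleton_zero (n := N.antennas (tierOf k z))
      (by have := N.two_le_antennas (tierOf k z); omega)
    rw [← hV.ueChannel_law z, Measure.map_apply (hV.ueChannel_measurable z)
      (measurableSet_singleton _)] at h1
    rw [ae_iff]
    simp only [not_not]
    exact h1
  have hae : ∀ᵐ ω ∂μ,
      ∫⁻ ω', F (V.eveChannel z m ω') (V.ueChannel z ω, V.noiseMatrix z ω) ∂μ = C := by
    filter_upwards [h0, hV.noiseMatrix_orthonormal z, hV.noiseMatrix_orthogonal z] with ω h1 h2 h3
    rw [← hC (V.ueChannel z ω) (V.noiseMatrix z ω) (sum_star_beam_mul_self h1) h2 h3,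
      ← hV.eveChannel_law z m, lintegral_map _ (hV.eveChannel_measurable z m)]
    exact hF.comp (measurable_id.prodMk measurable_const)
  rw [lintegral_congr_ae hae]
  simp

lemma one_le_antennas (j : Fin K) : 1 ≤ N.antennas j := one_le_two.trans (N.two_le_antennas j)

lemma IsNetwork.lintegral_expNeg_noiseGain (hV : V.IsNetwork μ A) (z : Transmitter K) (m : ℕ)
    (θ : ℝ≥0∞) :
    ∫⁻ ω, expNeg (θ * ENNReal.ofReal (noiseGain (V.eveChannel z m ω) (V.noiseMatrix z ω))) ∂μ =
      ((1 + θ)⁻¹) ^ (N.antennas (tierOf k z) - 1) := by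
  refine hV.lintegral_gain z m (F := fun h B => expNeg (θ * ENNReal.ofReal (noiseGain h B.2))) ?_ ?_
  · refine measurable_expNeg.comp (Measurable.const_mul (Measurable.ennreal_ofReal ?_) θ)
    exact measurable_noiseGain measurable_fst (measurable_snd.comp measurable_snd)
  · intro u W h1 h2 h3
    exact lintegral_rayleighLaw_expNeg_noise (one_le_antennas _) h1 h2 h3 θ

lemma IsNetwork.measure_noise_add_le_signal (hV : V.IsNetwork μ A) (z : Transmitter K) (m : ℕ)
    (θ c : ℝ≥0∞) :
    μ {ω | θ * ENNReal.ofReal (noiseGain (V.eveChannel z m ω) (V.noiseMatrix z ω)) + c ≤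
      ENNReal.ofReal (signalGain (V.eveChannel z m ω) (V.ueChannel z ω))} =
      ((1 + θ)⁻¹) ^ (N.antennas (tierOf k z) - 1) * expNeg c := by
  set S : Set ((Fin (N.antennas (tierOf k z)) → ℂ) × ((Fin (N.antennas (tierOf k z)) → ℂ) ×
      (Fin (N.antennas (tierOf k z)) → Fin (N.antennas (tierOf k z) - 1) → ℂ))) :=
    {q | θ * ENNReal.ofReal (noiseGain q.1 q.2.2) + c ≤ ENNReal.ofReal (signalGain q.1 q.2.1)}
  have hS : MeasurableSet S := by
    have h1 : Measurable fun q : (Fin (N.antennas (tierOf k z)) → ℂ) ×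
        ((Fin (N.antennas (tierOf k z)) → ℂ) ×
        (Fin (N.antennas (tierOf k z)) → Fin (N.antennas (tierOf k z) - 1) → ℂ)) =>
        noiseGain q.1 q.2.2 :=
      measurable_noiseGain measurable_fst (measurable_snd.comp measurable_snd)
    have h2 : Measurable fun q : (Fin (N.antennas (tierOf k z)) → ℂ) ×
        ((Fin (N.antennas (tierOf k z)) → ℂ) ×
        (Fin (N.antennas (tierOf k z)) → Fin (N.antennas (tierOf k z) - 1) → ℂ)) =>
        signalGain q.1 q.2.1 :=
      measurable_signalGain measurable_fst (measurable_fst.comp measurable_snd)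
    exact measurableSet_le ((h1.ennreal_ofReal.const_mul θ).add_const c) h2.ennreal_ofReal
  have hm : Measurable fun ω => (V.eveChannel z m ω, (V.ueChannel z ω, V.noiseMatrix z ω)) :=
    (hV.eveChannel_measurable z m).prodMk
      ((hV.ueChannel_measurable z).prodMk (hV.noiseMatrix_measurable z))
  have key := hV.lintegral_gain z m (F := fun h B => S.indicator 1 (h, B))
    (C := ((1 + θ)⁻¹) ^ (N.antennas (tierOf k z) - 1) * expNeg c)
    (measurable_one.indicator hS) (by
      intro u W h1 h2 h3
      rw [← rayleighLaw_noise_add_le_signal (one_le_antennas _) h1 h2 h3 c]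
      have hS' : MeasurableSet ((fun h => (h, (u, W))) ⁻¹' S) :=
        (measurable_id.prodMk measurable_const) hS
      exact lintegral_indicator_one hS')
  rw [← key]
  exact (lintegral_indicator_one (hm hS)).symm

lemma gainSources_disjoint_active (z : Transmitter K) (m : ℕ) (p : Fin K × ℕ) :
    Disjoint ({.active p.1 p.2} : Set (Source K)) (gainSources z m) := by
  simp [gainSources]

/-- The Laplace transform of the noise of an independently active base station. -/
lemma IsNetwork.lintegral_expNeg_activeNoiseGain (hV : V.IsNetwork μ A) (m : ℕ) (p : Fin K × ℕ)
    (θ : ℝ≥0∞) :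
    ∫⁻ ω, expNeg (θ * V.activeNoiseGain m p ω) ∂μ =
      ENNReal.ofReal (1 - A p.1) +
        ENNReal.ofReal (A p.1) * ((1 + θ)⁻¹) ^ (N.antennas p.1 - 1) := by
  set a : Set Ω := {ω | V.active p.1 p.2 ω = true}
  have ha : MeasurableSet a := hV.active_measurable p.1 p.2 (measurableSet_singleton true)
  have hμa : μ a = ENNReal.ofReal (A p.1) := by
    rw [← hV.active_law p.1 p.2, ofReal_measureReal]
  have hμa' : μ aᶜ = ENNReal.ofReal (1 - A p.1) := by
    rw [← hV.active_law p.1 p.2, ← probReal_compl_eq_one_sub ha, ofReal_measureReal]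
  set G : Ω → ℝ≥0∞ := fun ω =>
    expNeg (θ * ENNReal.ofReal (noiseGain (V.eveChannel (some p) m ω) (V.noiseMatrix (some p) ω)))
  have hGS : Measurable[⨆ s ∈ gainSources (some p) m, V.sourceSigma s] G :=
    measurable_expNeg.comp
      ((measurable_noiseGain_source (V := V) (some p) m le_rfl).ennreal_ofReal.const_mul θ)
  have haS : MeasurableSet[⨆ s ∈ ({.active p.1 p.2} : Set (Source K)), V.sourceSigma s] a :=
    measurable_active_source (V := V) p (Set.mem_singleton _) (measurableSet_singleton true)
  have e : ∀ ω, expNeg (θ * V.activeNoiseGain m p ω) =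
      aᶜ.indicator 1 ω + a.indicator 1 ω * G ω := by
    intro ω
    by_cases h : V.active p.1 p.2 ω = true
    · have h' : ω ∈ a := h
      simp [activeNoiseGain, h, h', G]
    · have h' : ω ∉ a := h
      simp [activeNoiseGain, h, h']
  simp_rw [e]
  rw [lintegral_add_left (measurable_one.indicator ha.compl),
    lintegral_indicator_one ha.compl, hμa',
    lintegral_mul_eq_lintegral_mul_lintegral_of_independent_measurableSpace
      (hV.iSup_source_le _) (hV.iSup_source_le _)
      (hV.indep_of_disjoint (gainSources_disjoint_active (some p) m p))
      (measurable_indicator_one haS) hGS, lintegral_indicator_one ha, hμa,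
    hV.lintegral_expNeg_noiseGain]
  rfl

end NetworkVars

/-! ### The conditional law of the SINR given the locations -/

lemma measurable_ennreal_tsum {β ι : Type*} [Countable ι] {_ : MeasurableSpace β}
    {f : ι → β → ℝ≥0∞} (hf : ∀ i, Measurable (f i)) : Measurable fun x => ∑' i, f i x :=
  Measurable.tsum hf

namespace HCN

variable {K : ℕ} (N : HCN K)

/-- The Laplace transform at `θ` of the artificial-noise gain of a base station of tier `j` that is
active with probability `A j`. -/
noncomputable def noiseLaplace (A : Fin K → ℝ) (j : Fin K) (θ : ℝ≥0∞) : ℝ≥0∞ :=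
  ENNReal.ofReal (1 - A j) + ENNReal.ofReal (A j) * ((1 + θ)⁻¹) ^ (N.antennas j - 1)

/-- The constant `β_e ξ_j (φ_j / φ_k) (P_j / P_k)`: the strength of the artificial noise of tier `j`
relative to the signal of tier `k`, scaled by the SINR threshold. -/
noncomputable def relNoise (k j : Fin K) (βe : ℝ) : ℝ :=
  βe * (N.xi j * (N.ratio j / N.ratio k) * (N.power j / N.power k))

/-- The weight of the artificial-noise gain of a base station of tier `j` at `y`, for an
eavesdropper at `x` listening to the serving base station at `b`. -/
noncomputable def noiseWeight (k : Fin K) (βe : ℝ) (b : Plane) (j : Fin K) (x y : Plane) : ℝ≥0∞ :=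
  ENNReal.ofReal (N.relNoise k j βe * dist b x ^ N.pathExp) * pathGain N.pathExp y x

/-- The factor `(1 + ξ_k β_e)^(1 - M_k)`, the effect of the artificial noise of the serving base
station. -/
noncomputable def servingFactor (k : Fin K) (βe : ℝ) : ℝ≥0∞ :=
  ((1 + ENNReal.ofReal (N.xi k * βe))⁻¹) ^ (N.antennas k - 1)

/-- The conditional probability that an eavesdropper at `x` reaches the SINR threshold, when the
other base stations are at the points `y j n`. -/
noncomputable def exposure (A : Fin K → ℝ) (k : Fin K) (βe : ℝ) (b x : Plane)
    (y : Fin K → ℕ → Plane) : ℝ≥0∞ :=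
  N.servingFactor k βe *
    expNeg (∑' p : Fin K × ℕ,
      negLog (N.noiseLaplace A p.1 (N.noiseWeight k βe b p.1 x (y p.1 p.2))))

lemma xi_nonneg (j : Fin K) : 0 ≤ N.xi j := by
  have h1 := N.ratio_pos j
  have h2 := N.ratio_le_one j
  have h3 : (2 : ℝ) ≤ N.antennas j := by exact_mod_cast N.two_le_antennas j
  have h4 : 1 ≤ (N.ratio j)⁻¹ := (one_le_inv₀ h1).2 h2
  exact div_nonneg (by linarith) (by linarith)

lemma relNoise_nonneg (k j : Fin K) {βe : ℝ} (hβ : 0 ≤ βe) : 0 ≤ N.relNoise k j βe := by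
  have h1 := N.ratio_pos j
  have h2 := N.ratio_pos k
  have h3 := N.power_pos j
  have h4 := N.power_pos k
  have h5 := N.xi_nonneg j
  unfold relNoise
  positivity

lemma servingFactor_le_one (k : Fin K) (βe : ℝ) : N.servingFactor k βe ≤ 1 :=
  pow_le_one₀ zero_le (ENNReal.inv_le_one.2 le_self_add)

lemma exposure_le_one (A : Fin K → ℝ) (k : Fin K) (βe : ℝ) (b x : Plane)
    (y : Fin K → ℕ → Plane) : N.exposure A k βe b x y ≤ 1 :=
  mul_le_one' (N.servingFactor_le_one k βe) (expNeg_le_one _)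

lemma noiseLaplace_le_one {A : Fin K → ℝ} {j : Fin K} (h0 : 0 ≤ A j) (h1 : A j ≤ 1) (θ : ℝ≥0∞) :
    N.noiseLaplace A j θ ≤ 1 := by
  have hp : ((1 + θ)⁻¹) ^ (N.antennas j - 1) ≤ 1 :=
    pow_le_one₀ zero_le (ENNReal.inv_le_one.2 le_self_add)
  calc N.noiseLaplace A j θ ≤ ENNReal.ofReal (1 - A j) + ENNReal.ofReal (A j) * 1 := by
        unfold noiseLaplace
        gcongr
    _ = 1 := by
        rw [mul_one, ← ENNReal.ofReal_add (by linarith) h0, sub_add_cancel, ENNReal.ofReal_one]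

lemma measurable_noiseLaplace (A : Fin K → ℝ) (j : Fin K) : Measurable (N.noiseLaplace A j) := by
  unfold noiseLaplace
  fun_prop

lemma measurable_noiseWeight {β : Type*} [MeasurableSpace β] (k : Fin K) (βe : ℝ) (b : Plane)
    (j : Fin K) {f g : β → Plane} (hf : Measurable f) (hg : Measurable g) :
    Measurable fun p => N.noiseWeight k βe b j (f p) (g p) := by
  unfold noiseWeight
  refine Measurable.mul (Measurable.ennreal_ofReal (Measurable.const_mul ?_ _))
    (measurable_pathGain hg hf)
  exact (measurable_const.dist hf).pow_const _

lemma measurable_exposure {β : Type*} [MeasurableSpace β] (A : Fin K → ℝ) (k : Fin K) (βe : ℝ)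
    (b : Plane) {f : β → Plane} {g : β → Fin K → ℕ → Plane} (hf : Measurable f)
    (hg : Measurable g) : Measurable fun p => N.exposure A k βe b (f p) (g p) := by
  unfold exposure
  refine Measurable.const_mul (measurable_expNeg.comp (Measurable.tsum fun p => ?_)) _
  refine measurable_negLog.comp ((N.measurable_noiseLaplace A p.1).comp ?_)
  exact N.measurable_noiseWeight k βe b p.1 hf
    ((measurable_pi_apply p.2).comp ((measurable_pi_apply p.1).comp hg))

end HCN

namespace NetworkVars

variable {K : ℕ} {N : HCN K} {k : Fin K} {Ω : Type*} {V : NetworkVars N k Ω}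

lemma pairwise_disjoint_noiseSources (m : ℕ) :
    Pairwise fun p q : Fin K × ℕ => Disjoint (noiseSources m p) (noiseSources m q) := by
  rintro ⟨i, n⟩ ⟨j, l⟩ h
  rw [Set.disjoint_left]
  rintro s hs hs'
  simp only [noiseSources, Set.mem_insert_iff, Set.mem_singleton_iff] at hs hs'
  rcases hs with rfl | rfl | rfl <;> simp_all

lemma disjoint_noiseSources_gainSources (m : ℕ) :
    Disjoint (⋃ p : Fin K × ℕ, noiseSources m p) (gainSources none m) := by
  rw [Set.disjoint_left]
  intro s hs hs'
  simp only [noiseSources, gainSources, Set.mem_iUnion, Set.mem_insert_iff,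
    Set.mem_singleton_iff] at hs hs'
  obtain ⟨p, hs⟩ := hs
  rcases hs' with rfl | rfl <;> simp at hs

/-- Without thermal noise, the SINR is below the threshold exactly if the signal gain is less than
the weighted sum of the noise gains. A positive signal gain excludes the convention `0 / 0 = 0`. -/
lemma sinr_lt_iff {b : Plane} {βe : ℝ} (hβ : 0 < βe) (m : ℕ) {ω : Ω} (hb : V.eve m ω ≠ b)
    (hT : 0 < ENNReal.ofReal (signalGain (V.eveChannel none m ω) (V.ueChannel none ω))) :
    V.sinr 0 b m ω < ENNReal.ofReal βe ↔
      ENNReal.ofReal (signalGain (V.eveChannel none m ω) (V.ueChannel none ω)) <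
        ENNReal.ofReal (N.xi k * βe) *
          ENNReal.ofReal (noiseGain (V.eveChannel none m ω) (V.noiseMatrix none ω)) +
        ∑' p : Fin K × ℕ, N.noiseWeight k βe b p.1 (V.eve m ω) (V.bs p.1 p.2 ω) *
          V.activeNoiseGain m p ω := by
  set T := ENNReal.ofReal (signalGain (V.eveChannel none m ω) (V.ueChannel none ω)) with hTdef
  have hd : 0 < dist b (V.eve m ω) := dist_pos.2 hb.symm
  have hφ := N.ratio_pos k
  have hP := N.power_pos k
  set d := dist b (V.eve m ω) with hddef
  set s : ℝ := N.ratio k * N.power k * d ^ (-N.pathExp) with hs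
  have hs0 : 0 < s := by positivity
  have hρ : pathGain N.pathExp b (V.eve m ω) = ENNReal.ofReal (d ^ (-N.pathExp)) :=
    pathGain_of_ne hb.symm
  have hsig : V.signalPower b m ω = ENNReal.ofReal s * T := by
    have : V.signalPower b m ω = ENNReal.ofReal (N.ratio k * N.power k *
      signalGain (V.eveChannel none m ω) (V.ueChannel none ω)) *
        pathGain N.pathExp b (V.eve m ω) := rfl
    have h0 : 0 ≤ N.ratio k * N.power k := by positivity
    rw [this, hρ, ENNReal.ofReal_mul h0, hs, ENNReal.ofReal_mul h0]
    exact mul_right_comm _ _ _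
  have hM : ∀ j, (0 : ℝ) < (N.antennas j : ℝ) - 1 := fun j => by
    have : (2 : ℝ) ≤ N.antennas j := by exact_mod_cast N.two_le_antennas j
    linarith
  have hnoise : ∀ z : Transmitter K, V.noisePower b z m ω =
      ENNReal.ofReal ((1 - N.ratio (tierOf k z)) * N.power (tierOf k z) /
        ((N.antennas (tierOf k z) : ℝ) - 1)) *
        ENNReal.ofReal (noiseGain (V.eveChannel z m ω) (V.noiseMatrix z ω)) *
          pathGain N.pathExp (V.txLocation b ω z) (V.eve m ω) := by
    intro z
    have e : V.noisePower b z m ω = ENNReal.ofReal ((1 - N.ratio (tierOf k z)) *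
        N.power (tierOf k z) * noiseGain (V.eveChannel z m ω) (V.noiseMatrix z ω) /
        ((N.antennas (tierOf k z) : ℝ) - 1)) *
          pathGain N.pathExp (V.txLocation b ω z) (V.eve m ω) := rfl
    have h1 := N.ratio_le_one (tierOf k z)
    have h2 := N.power_pos (tierOf k z)
    rw [e, ← ENNReal.ofReal_mul (div_nonneg (mul_nonneg (by linarith) h2.le) (hM _).le)]
    congr 2
    ring
  have hsum : ENNReal.ofReal βe * (V.noisePower b none m ω +
      (∑' p : Fin K × ℕ, if V.active p.1 p.2 ω then V.noisePower b (some p) m ω else 0) +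
      ENNReal.ofReal 0) = ENNReal.ofReal s * (ENNReal.ofReal (N.xi k * βe) *
          ENNReal.ofReal (noiseGain (V.eveChannel none m ω) (V.noiseMatrix none ω)) +
        ∑' p : Fin K × ℕ, N.noiseWeight k βe b p.1 (V.eve m ω) (V.bs p.1 p.2 ω) *
          V.activeNoiseGain m p ω) := by
    rw [ENNReal.ofReal_zero, add_zero, mul_add, mul_add, ← ENNReal.tsum_mul_left,
      ← ENNReal.tsum_mul_left]
    congr 1
    · rw [hnoise none]
      change _ * (_ * _ * pathGain N.pathExp b (V.eve m ω)) = _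
      have h1 := N.ratio_le_one k
      have hcoef : ENNReal.ofReal βe * ENNReal.ofReal ((1 - N.ratio k) * N.power k /
          ((N.antennas k : ℝ) - 1)) * ENNReal.ofReal (d ^ (-N.pathExp)) =
          ENNReal.ofReal s * ENNReal.ofReal (N.xi k * βe) := by
        rw [← ENNReal.ofReal_mul hβ.le, ← ENNReal.ofReal_mul hs0.le, ← ENNReal.ofReal_mul
          (mul_nonneg hβ.le (div_nonneg (mul_nonneg (by linarith) hP.le) (hM _).le))]
        congr 1
        rw [hs, HCN.xi]
        have := (hM k).ne'
        field_simp
      rw [hρ, ← mul_assoc (ENNReal.ofReal s), ← hcoef]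
      simp only [tierOf]
      ring
    · refine tsum_congr fun p => ?_
      by_cases hact : V.active p.1 p.2 ω = true
      · rw [if_pos hact, activeNoiseGain, if_pos hact, hnoise (some p), HCN.noiseWeight]
        change _ * (_ * _ * pathGain N.pathExp (V.bs p.1 p.2 ω) (V.eve m ω)) = _
        have h1 := N.ratio_le_one p.1
        have h2 := N.power_pos p.1
        have h3 := N.relNoise_nonneg k p.1 hβ.le
        have hcoef : ENNReal.ofReal βe * ENNReal.ofReal ((1 - N.ratio p.1) * N.power p.1 /
            ((N.antennas p.1 : ℝ) - 1)) = ENNReal.ofReal s *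
            ENNReal.ofReal (N.relNoise k p.1 βe * d ^ N.pathExp) := by
          rw [← ENNReal.ofReal_mul hβ.le, ← ENNReal.ofReal_mul hs0.le]
          congr 1
          rw [hs, HCN.relNoise, HCN.xi, Real.rpow_neg hd.le]
          have := (hM p.1).ne'
          have := (N.ratio_pos p.1).ne'
          have := (Real.rpow_pos_of_pos hd N.pathExp).ne'
          field_simp
        simp only [tierOf] at *
        rw [← mul_assoc, ← mul_assoc, hcoef]
        ring
      · rw [if_neg hact, activeNoiseGain, if_neg hact]
        simp
  have hsT0 : ENNReal.ofReal s * T ≠ 0 := mul_ne_zero (by simpa using hs0) hT.ne'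
  have hsTt : ENNReal.ofReal s * T ≠ ⊤ :=
    ENNReal.mul_ne_top ENNReal.ofReal_ne_top ENNReal.ofReal_ne_top
  rw [sinr, hsig, ENNReal.div_lt_iff (Or.inr hsT0) (Or.inr hsTt), hsum,
    ENNReal.mul_lt_mul_iff_right (by simpa using hs0) ENNReal.ofReal_ne_top]

/-- The sources that determine the locations of eavesdroppers and base stations. -/
def locationSources : Set (Source K) := insert .eve (Set.range .bs)

lemma locationSigma_le_iSup : V.locationSigma ≤ ⨆ s ∈ locationSources, V.sourceSigma s :=
  sup_le (le_iSup₂_of_le .eve (Set.mem_insert _ _) le_rfl)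
    (iSup_le fun j => le_iSup₂_of_le (.bs j) (Set.mem_insert_of_mem _ ⟨j, rfl⟩) le_rfl)

lemma measurable_bs_iSup_source : Measurable[⨆ s ∈ Set.range (Source.bs (K := K)),
    V.sourceSigma s] (fun ω j n => V.bs j n ω) := by
  refine @measurable_pi_lambda _ _ _ (⨆ s ∈ Set.range (Source.bs (K := K)), V.sourceSigma s)
    _ _ fun j => ?_
  have hj : V.sourceSigma (.bs j) ≤ ⨆ s ∈ Set.range (Source.bs (K := K)), V.sourceSigma s :=
    le_iSup₂_of_le (f := fun s (_ : s ∈ Set.range (Source.bs (K := K))) => V.sourceSigma s)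
      (.bs j) ⟨j, rfl⟩ le_rfl
  exact Measurable.mono (comap_measurable fun ω n => V.bs j n ω) hj le_rfl

lemma measurable_bs_locationSigma : Measurable[V.locationSigma] (fun ω j n => V.bs j n ω) := by
  refine @measurable_pi_lambda _ _ _ (V.locationSigma) _ _ fun j => ?_
  exact (comap_measurable (fun ω n => V.bs j n ω)).mono
    ((le_iSup (fun j => V.sourceSigma (.bs j)) j).trans le_sup_right) le_rfl

lemma measurable_eve_locationSigma : Measurable[V.locationSigma] (fun ω m => V.eve m ω) :=
  (comap_measurable (fun ω m => V.eve m ω)).mono le_sup_left le_rfl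

variable [mΩ : MeasurableSpace Ω] {μ : Measure Ω} {A : Fin K → ℝ}

lemma IsNetwork.activation_nonneg (hV : V.IsNetwork μ A) (j : Fin K) : 0 ≤ A j := by
  rw [← hV.active_law j 0]
  exact measureReal_nonneg

variable [IsProbabilityMeasure μ]

lemma IsNetwork.activation_le_one (hV : V.IsNetwork μ A) (j : Fin K) : A j ≤ 1 := by
  rw [← hV.active_law j 0]
  exact measureReal_le_one

/-- With fixed weights, the probability that the signal dominates the weighted artificial noise of
the serving and of the other base stations. -/
lemma IsNetwork.measure_weighted_noise_le_signal (hV : V.IsNetwork μ A) (m : ℕ) (θ₀ : ℝ≥0∞)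
    (θ : Fin K × ℕ → ℝ≥0∞) :
    μ {ω | θ₀ * ENNReal.ofReal (noiseGain (V.eveChannel none m ω) (V.noiseMatrix none ω)) +
        ∑' p, θ p * V.activeNoiseGain m p ω ≤
      ENNReal.ofReal (signalGain (V.eveChannel none m ω) (V.ueChannel none ω))} =
      ((1 + θ₀)⁻¹) ^ (N.antennas k - 1) * expNeg (∑' p, negLog (N.noiseLaplace A p.1 (θ p))) := by
  set U : Set (Source K) := ⋃ p : Fin K × ℕ, noiseSources m p
  set G : Ω → ℝ≥0∞ := fun ω =>
    ENNReal.ofReal (noiseGain (V.eveChannel none m ω) (V.noiseMatrix none ω))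
  set T : Ω → ℝ≥0∞ := fun ω =>
    ENNReal.ofReal (signalGain (V.eveChannel none m ω) (V.ueChannel none ω))
  set Q : Ω → ℝ≥0∞ := fun ω => ∑' p, θ p * V.activeNoiseGain m p ω
  have hQS : Measurable[⨆ s ∈ U, V.sourceSigma s] Q :=
    measurable_ennreal_tsum fun p =>
      (measurable_activeNoiseGain m p (Set.subset_iUnion _ p)).const_mul (θ p)
  have hGS := (measurable_noiseGain_source (V := V) none m le_rfl).ennreal_ofReal
  have hTS := (measurable_signalGain_source (V := V) none m le_rfl).ennreal_ofReal
  have hI : IndepFun Q (fun ω => (G ω, T ω)) μ :=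
    hV.indepFun (disjoint_noiseSources_gainSources m) hQS (hGS.prodMk hTS)
  have hQ : Measurable Q := hQS.mono (hV.iSup_source_le _) le_rfl
  have hG : Measurable G := hGS.mono (hV.iSup_source_le _) le_rfl
  have hT : Measurable T := hTS.mono (hV.iSup_source_le _) le_rfl
  have hS : MeasurableSet {q : ℝ≥0∞ × (ℝ≥0∞ × ℝ≥0∞) | θ₀ * q.2.1 + q.1 ≤ q.2.2} :=
    measurableSet_le (by fun_prop) (by fun_prop)
  have key := hI.lintegral_prodMk hQ (hG.prodMk hT)
    (F := fun q r => {q : ℝ≥0∞ × (ℝ≥0∞ × ℝ≥0∞) | θ₀ * q.2.1 + q.1 ≤ q.2.2}.indicator 1 (q, r))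
    (measurable_indicator_one hS)
  have e1 : μ {ω | θ₀ * G ω + Q ω ≤ T ω} = ∫⁻ ω,
      {q : ℝ≥0∞ × (ℝ≥0∞ × ℝ≥0∞) | θ₀ * q.2.1 + q.1 ≤ q.2.2}.indicator 1 (Q ω, (G ω, T ω)) ∂μ :=
    (lintegral_indicator_one (measurableSet_le ((hG.const_mul θ₀).add hQ) hT)).symm
  have e2 : ∀ ω, ∫⁻ ω', {q : ℝ≥0∞ × (ℝ≥0∞ × ℝ≥0∞) | θ₀ * q.2.1 + q.1 ≤ q.2.2}.indicator 1
      (Q ω, (G ω', T ω')) ∂μ = ((1 + θ₀)⁻¹) ^ (N.antennas k - 1) * expNeg (Q ω) := by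
    intro ω
    refine Eq.trans ?_ (hV.measure_noise_add_le_signal none m θ₀ (Q ω))
    exact lintegral_indicator_one (measurableSet_le ((hG.const_mul θ₀).add_const _) hT)
  have hQe : Measurable fun ω => expNeg (Q ω) := measurable_expNeg.comp hQ
  rw [e1, key, lintegral_congr e2, lintegral_const_mul _ hQe]
  congr 1
  refine hV.independent.lintegral_expNeg_tsum hV.sourceSigma_le (pairwise_disjoint_noiseSources m)
    (fun p => (measurable_activeNoiseGain m p le_rfl).const_mul (θ p)) fun p => ?_
  rw [hV.lintegral_expNeg_activeNoiseGain, expNeg_negLog]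
  · rfl
  · exact N.noiseLaplace_le_one (hV.activation_nonneg _) (hV.activation_le_one _) _

/-- The signal gain is an exponential variable, hence positive. -/
lemma IsNetwork.ae_signalGain_pos (hV : V.IsNetwork μ A) (m : ℕ) :
    ∀ᵐ ω ∂μ, 0 < ENNReal.ofReal (signalGain (V.eveChannel none m ω) (V.ueChannel none ω)) := by
  refine ae_pos_of_measure_le_eq_expNeg ?_ fun c => ?_
  · exact ((measurable_signalGain_source (V := V) none m le_rfl).mono
      (hV.iSup_source_le _) le_rfl).ennreal_ofReal
  · have := hV.measure_noise_add_le_signal none m 0 c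
    simpa using this

lemma IsNetwork.ae_eve_ne (hV : V.IsNetwork μ A) (b : Plane) : ∀ᵐ ω ∂μ, ∀ m, V.eve m ω ≠ b := by
  have h := hV.eve_poisson.measure_forall_notMem (measurableSet_singleton b)
  rw [measure_singleton, mul_zero, expNeg_zero] at h
  have hm : MeasurableSet {ω | ∀ n, V.eve n ω ∉ ({b} : Set Plane)} := by
    simp only [Set.ofPred_forall]
    exact MeasurableSet.iInter fun n =>
      (hV.eve_poisson.measurable n) (measurableSet_singleton b).compl
  exact (prob_compl_eq_zero_iff hm).2 h

lemma IsNetwork.condProb_sinr_lt (hV : V.IsNetwork μ A) (b : Plane) {βe : ℝ} (hβ : 0 < βe)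
    (m : ℕ) :
    μ⟦{ω | V.sinr 0 b m ω < ENNReal.ofReal βe} | V.locationSigma⟧ =ᵐ[μ]
      fun ω => (1 - N.exposure A k βe b (V.eve m ω) (fun j n => V.bs j n ω)).toReal := by
  have hle : V.locationSigma ≤ mΩ := locationSigma_le_iSup.trans (hV.iSup_source_le _)
  set U : Set (Source K) := gainSources none m ∪ ⋃ p : Fin K × ℕ, noiseSources m p
  set G : Ω → ℝ≥0∞ := fun ω =>
    ENNReal.ofReal (noiseGain (V.eveChannel none m ω) (V.noiseMatrix none ω))
  set T : Ω → ℝ≥0∞ := fun ω =>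
    ENNReal.ofReal (signalGain (V.eveChannel none m ω) (V.ueChannel none ω))
  set L : Ω → Plane × (Fin K → ℕ → Plane) := fun ω => (V.eve m ω, fun j n => V.bs j n ω)
  set R : Ω → (ℝ≥0∞ × ℝ≥0∞) × (Fin K × ℕ → ℝ≥0∞) := fun ω =>
    ((T ω, G ω), fun p => V.activeNoiseGain m p ω)
  have hL : Measurable[V.locationSigma] L :=
    ((measurable_pi_apply m).comp measurable_eve_locationSigma).prodMk measurable_bs_locationSigma
  have hGS : Measurable[⨆ s ∈ U, V.sourceSigma s] G :=
    (measurable_noiseGain_source none m Set.subset_union_left).ennreal_ofReal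
  have hTS : Measurable[⨆ s ∈ U, V.sourceSigma s] T :=
    (measurable_signalGain_source none m Set.subset_union_left).ennreal_ofReal
  have hXS : Measurable[⨆ s ∈ U, V.sourceSigma s] fun ω p => V.activeNoiseGain m p ω :=
    @measurable_pi_lambda _ _ _ (⨆ s ∈ U, V.sourceSigma s) _ _ fun p =>
      measurable_activeNoiseGain m p ((Set.subset_iUnion (noiseSources m) p).trans
        Set.subset_union_right)
  have hRS : Measurable[⨆ s ∈ U, V.sourceSigma s] R := (hTS.prodMk hGS).prodMk hXS
  have hR : Measurable R := hRS.mono (hV.iSup_source_le _) le_rfl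
  have hdisj : Disjoint locationSources U := by
    rw [Set.disjoint_left]
    intro s hs hs'
    simp only [locationSources, U, gainSources, noiseSources, Set.mem_insert_iff, Set.mem_range,
      Set.mem_union, Set.mem_singleton_iff, Set.mem_iUnion] at hs hs'
    rcases hs with rfl | ⟨j, rfl⟩ <;> simp at hs'
  have hI : Indep V.locationSigma (MeasurableSpace.comap R inferInstance) μ :=
    indep_of_indep_of_le_left (indep_of_indep_of_le_right (hV.indep_of_disjoint hdisj)
      hRS.comap_le) locationSigma_le_iSup
  set S : Set ((Plane × (Fin K → ℕ → Plane)) × ((ℝ≥0∞ × ℝ≥0∞) × (Fin K × ℕ → ℝ≥0∞))) :=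
    {q | ENNReal.ofReal (N.xi k * βe) * q.2.1.2 +
      ∑' p : Fin K × ℕ, N.noiseWeight k βe b p.1 q.1.1 (q.1.2 p.1 p.2) * q.2.2 p ≤ q.2.1.1}
    with hSdef
  have hS : MeasurableSet S := by
    refine measurableSet_le (Measurable.add (by fun_prop) (Measurable.tsum fun p => ?_))
      (by fun_prop)
    refine Measurable.mul (N.measurable_noiseWeight k βe b p.1 (by fun_prop) ?_) (by fun_prop)
    exact (measurable_pi_apply p.2).comp ((measurable_pi_apply p.1).comp
      (measurable_snd.comp measurable_fst))
  have hev : ({ω | V.sinr 0 b m ω < ENNReal.ofReal βe}.indicator fun _ => (1 : ℝ)) =ᵐ[μ]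
      {ω | (L ω, R ω) ∈ Sᶜ}.indicator fun _ => (1 : ℝ) := by
    filter_upwards [hV.ae_eve_ne b, hV.ae_signalGain_pos m] with ω h1 h2
    have hiff : ω ∈ {ω | V.sinr 0 b m ω < ENNReal.ofReal βe} ↔ ω ∈ {ω | (L ω, R ω) ∈ Sᶜ} :=
      (sinr_lt_iff hβ m (h1 m) h2).trans not_le.symm
    simp only [Set.indicator_apply, hiff]
  refine (condExp_congr_ae hev).trans
    ((condExp_indicator_prodMk_of_indep hle hL hR hI hS.compl).trans (ae_of_all _ fun ω => ?_))
  have hSω : MeasurableSet {ω' | (L ω, R ω') ∈ S} := (measurable_const.prodMk hR) hS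
  have hμ : μ {ω' | (L ω, R ω') ∈ S} =
      N.exposure A k βe b (V.eve m ω) (fun j n => V.bs j n ω) :=
    hV.measure_weighted_noise_le_signal m (ENNReal.ofReal (N.xi k * βe))
      fun p => N.noiseWeight k βe b p.1 (V.eve m ω) (V.bs p.1 p.2 ω)
  change (μ {ω' | (L ω, R ω') ∈ Sᶜ}).toReal = _
  congr 1
  rw [← hμ, ← prob_compl_eq_one_sub hSω]
  rfl

/-- The secrecy probability as the mean of the product over all eavesdroppers of the probabilities
that they stay below the threshold. -/
lemma IsNetwork.secrecyProb_eq (hV : V.IsNetwork μ A) (b : Plane) {βe : ℝ} (hβ : 0 < βe) :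
    V.secrecyProb μ 0 b βe = (∫⁻ ω, expNeg (∑' m,
      negLog (1 - N.exposure A k βe b (V.eve m ω) (fun j n => V.bs j n ω))) ∂μ).toReal := by
  have hae : ∀ᵐ ω ∂μ, ∏' m, (μ⟦{ω' | V.sinr 0 b m ω' < ENNReal.ofReal βe} | V.locationSigma⟧) ω =
      (expNeg (∑' m, negLog (1 - N.exposure A k βe b (V.eve m ω)
        (fun j n => V.bs j n ω)))).toReal := by
    filter_upwards [ae_all_iff.2 fun m => hV.condProb_sinr_lt b hβ m] with ω hω
    rw [← tprod_toReal_expNeg]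
    refine tprod_congr fun m => ?_
    rw [hω m, expNeg_negLog tsub_le_self]
  rw [secrecyProb, integral_congr_ae hae, integral_toReal]
  · refine (measurable_expNeg.comp (Measurable.tsum fun m => ?_)).aemeasurable
    refine measurable_negLog.comp (measurable_const.sub
      (N.measurable_exposure A k βe b (hV.eve_poisson.measurable m) ?_))
    exact measurable_pi_lambda _ fun j => measurable_pi_lambda _ fun n =>
      (hV.bs_poisson j).measurable n
  · exact ae_of_all _ fun ω => lt_of_le_of_lt (expNeg_le_one _) ENNReal.one_lt_top

end NetworkVars

/-! ### Averaging over the locations -/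

/-- Jensen's inequality for the convex function `t ↦ exp (-t)`. -/
lemma expNeg_lintegral_le {β : Type*} [MeasurableSpace β] {ν : Measure β} [IsProbabilityMeasure ν]
    {f : β → ℝ≥0∞} (hf : Measurable f) : expNeg (∫⁻ x, f x ∂ν) ≤ ∫⁻ x, expNeg (f x) ∂ν := by
  by_cases hI : ∫⁻ x, f x ∂ν = ⊤
  · simp [hI]
  set I := ∫⁻ x, f x ∂ν with hIdef
  -- the tangent line at the mean lies below the graph
  have tangent : ∀ t : ℝ≥0∞, expNeg I * (1 + I) ≤ expNeg t + expNeg I * t := by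
    intro t
    by_cases ht : t = ⊤
    · have hI0 : expNeg I ≠ 0 := by
        rw [expNeg_eq_of_ne_top hI]
        simpa using Real.exp_pos _
      simp [ht, ENNReal.mul_top hI0]
    have h := Real.add_one_le_exp (I.toReal - t.toReal)
    rw [expNeg_eq_of_ne_top hI, expNeg_eq_of_ne_top ht]
    nth_rewrite 2 [← ENNReal.ofReal_toReal hI]
    nth_rewrite 2 [← ENNReal.ofReal_toReal ht]
    have e0 := Real.exp_pos (-I.toReal)
    have i0 : 0 ≤ I.toReal := ENNReal.toReal_nonneg
    have t0 : 0 ≤ t.toReal := ENNReal.toReal_nonneg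
    rw [← ENNReal.ofReal_one, ← ENNReal.ofReal_add zero_le_one i0, ← ENNReal.ofReal_mul e0.le,
      ← ENNReal.ofReal_mul e0.le, ← ENNReal.ofReal_add (Real.exp_pos _).le (by positivity)]
    refine ENNReal.ofReal_le_ofReal ?_
    have h2 : Real.exp (-t.toReal) = Real.exp (-I.toReal) * Real.exp (I.toReal - t.toReal) := by
      rw [← Real.exp_add]
      ring_nf
    rw [h2]
    nlinarith
  have h1 : ∫⁻ _, expNeg I * (1 + I) ∂ν ≤ ∫⁻ x, (expNeg (f x) + expNeg I * f x) ∂ν :=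
    lintegral_mono fun x => tangent (f x)
  rw [lintegral_const, measure_univ, mul_one,
    lintegral_add_right _ (hf.const_mul _), lintegral_const_mul _ hf, mul_add, mul_one,
    ← hIdef] at h1
  exact (ENNReal.add_le_add_iff_right (ENNReal.mul_ne_top (expNeg_ne_top I) hI)).1 h1

namespace HCN

variable {K : ℕ} (N : HCN K)

lemma interferenceConst_pos (j : Fin K) : 0 < interferenceConst N.pathExp (N.antennas j) := by
  have h1 : (2 : ℝ) ≤ N.antennas j := by exact_mod_cast N.two_le_antennas j
  have h2 := N.two_lt_pathExp
  have h3 : 2 / N.pathExp < 1 := by rw [div_lt_one (by linarith)]; exact h2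
  have h4 : 0 < 2 / N.pathExp := by positivity
  exact div_pos (mul_pos (Real.Gamma_pos_of_pos (by linarith))
    (Real.Gamma_pos_of_pos (by linarith))) (Real.Gamma_pos_of_pos (by linarith))

lemma psi_term_nonneg {A : Fin K → ℝ} (hA : ∀ j, 0 ≤ A j) (k j : Fin K) :
    0 ≤ A j * N.bsDensity j * interferenceConst N.pathExp (N.antennas j) *
      (N.xi j * (N.ratio j / N.ratio k) * (N.power j / N.power k)) ^ N.delta := by
  have h0 := hA j
  have h1 := N.bsDensity_pos j
  have h2 := N.interferenceConst_pos j
  have h3 := N.xi_nonneg j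
  have h4 := N.ratio_pos j
  have h5 := N.ratio_pos k
  have h6 := N.power_pos j
  have h7 := N.power_pos k
  positivity

lemma psi_nonneg {A : Fin K → ℝ} (hA : ∀ j, 0 ≤ A j) (k : Fin K) : 0 ≤ N.psi A k :=
  Finset.sum_nonneg fun j _ => N.psi_term_nonneg hA k j

lemma psi_pos {A : Fin K → ℝ} (hA : ∀ j, 0 < A j) (k : Fin K) (h : ∃ j, N.ratio j < 1) :
    0 < N.psi A k := by
  obtain ⟨j, hj⟩ := h
  refine Finset.sum_pos' (fun j _ => N.psi_term_nonneg (fun j => (hA j).le) k j)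
    ⟨j, Finset.mem_univ _, ?_⟩
  have h0 := hA j
  have h1 := N.bsDensity_pos j
  have h2 := N.interferenceConst_pos j
  have h4 := N.ratio_pos j
  have h5 := N.ratio_pos k
  have h6 := N.power_pos j
  have h7 := N.power_pos k
  have h8 : (2 : ℝ) ≤ N.antennas j := by exact_mod_cast N.two_le_antennas j
  have h3 : 0 < N.xi j := div_pos (by linarith [(one_lt_inv₀ h4).2 hj]) (by linarith)
  positivity

lemma servingFactor_eq (k : Fin K) {βe : ℝ} (hβ : 0 < βe) :
    N.servingFactor k βe =
      ENNReal.ofReal ((1 + N.xi k * βe) ^ (1 - (N.antennas k : ℝ))) := by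
  have h0 : 0 < 1 + N.xi k * βe := by
    have := N.xi_nonneg k
    positivity
  have h2 := N.two_le_antennas k
  rw [servingFactor, ← ENNReal.ofReal_one, ← ENNReal.ofReal_add zero_le_one
    (mul_nonneg (N.xi_nonneg k) hβ.le), ← ENNReal.ofReal_inv_of_pos h0,
    ← ENNReal.ofReal_pow (by positivity)]
  congr 1
  rw [inv_pow, ← Real.rpow_natCast, ← Real.rpow_neg h0.le, Nat.cast_sub (by omega)]
  congr 1
  push_cast
  ring

/-- The area integral for the interference of one tier. -/
lemma lintegral_one_sub_noiseLaplace {A : Fin K → ℝ} {j : Fin K} (h0 : 0 ≤ A j) (h1 : A j ≤ 1)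
    (k : Fin K) {βe : ℝ} (hβ : 0 < βe) (b x : Plane) :
    ∫⁻ y, (1 - N.noiseLaplace A j (N.noiseWeight k βe b j x y)) =
      ENNReal.ofReal (Real.pi * βe ^ N.delta * (A j *
        interferenceConst N.pathExp (N.antennas j) *
        (N.xi j * (N.ratio j / N.ratio k) * (N.power j / N.power k)) ^ N.delta) *
          dist x b ^ 2) := by
  have hα := N.two_lt_pathExp
  have hα0 : 0 < N.pathExp := by linarith
  have hM := N.two_le_antennas j
  have hq := N.relNoise_nonneg k j hβ.le
  have hle : ∀ θ : ℝ≥0∞, ((1 + θ)⁻¹) ^ (N.antennas j - 1) ≤ 1 := fun θ =>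
    pow_le_one₀ zero_le (ENNReal.inv_le_one.2 le_self_add)
  have e : ∀ θ, 1 - N.noiseLaplace A j θ =
      ENNReal.ofReal (A j) * (1 - ((1 + θ)⁻¹) ^ (N.antennas j - 1)) := by
    intro θ
    refine ENNReal.sub_eq_of_eq_add (ne_top_of_le_ne_top ENNReal.one_ne_top
      (N.noiseLaplace_le_one h0 h1 θ)) ?_
    rw [noiseLaplace, add_left_comm, ← mul_add, tsub_add_cancel_of_le (hle θ), mul_one,
      ← ENNReal.ofReal_add (by linarith) h0, sub_add_cancel, ENNReal.ofReal_one]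
  simp_rw [e]
  rw [lintegral_const_mul' _ _ ENNReal.ofReal_ne_top]
  simp only [noiseWeight]
  rw [lintegral_one_sub_inv_one_add_pathGain_pow hα (by positivity) (by omega),
    ← ENNReal.ofReal_mul h0]
  congr 1
  have hc : 0 ≤ N.xi j * (N.ratio j / N.ratio k) * (N.power j / N.power k) := by
    have := N.relNoise_nonneg k j zero_le_one
    rwa [relNoise, one_mul] at this
  have hd : (dist b x ^ N.pathExp) ^ (2 / N.pathExp) = dist x b ^ 2 := by
    rw [← Real.rpow_mul dist_nonneg, mul_div_cancel₀ _ hα0.ne', dist_comm]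
    exact Real.rpow_natCast _ 2
  rw [Real.mul_rpow hq (by positivity), hd, relNoise, Real.mul_rpow hβ.le hc, interferenceConst,
    Nat.cast_sub (by omega), delta]
  push_cast
  ring

end HCN

namespace NetworkVars

variable {K : ℕ} {N : HCN K} {k : Fin K} {Ω : Type*} {V : NetworkVars N k Ω}
  [mΩ : MeasurableSpace Ω] {μ : Measure Ω} {A : Fin K → ℝ}

lemma IsNetwork.measurable_bs (hV : V.IsNetwork μ A) : Measurable fun ω j n => V.bs j n ω :=
  measurable_pi_lambda _ fun j => measurable_pi_lambda _ fun n => (hV.bs_poisson j).measurable n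

lemma IsNetwork.indepFun_bs_eve (hV : V.IsNetwork μ A) :
    IndepFun (fun ω j n => V.bs j n ω) (fun ω m => V.eve m ω) μ :=
  hV.indepFun (S := Set.range (Source.bs (K := K))) (T := {Source.eve}) (by simp)
    measurable_bs_iSup_source
    (measurable_iSup_source (Set.mem_singleton _) (comap_measurable fun ω m => V.eve m ω))

lemma IsNetwork.indepFun_bs_ue (hV : V.IsNetwork μ A) :
    IndepFun (fun ω j n => V.bs j n ω) (fun ω m => V.ue m ω) μ :=
  hV.indepFun (S := Set.range (Source.bs (K := K))) (T := {Source.ue}) (by simp)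
    measurable_bs_iSup_source
    (measurable_iSup_source (Set.mem_singleton _) (comap_measurable fun ω m => V.ue m ω))

variable [IsProbabilityMeasure μ]

/-- The mean exposure at a point, over the base station locations. -/
lemma IsNetwork.lintegral_exposure (hV : V.IsNetwork μ A) (b x : Plane) {βe : ℝ} (hβ : 0 < βe) :
    ∫⁻ ω, N.exposure A k βe b x (fun j n => V.bs j n ω) ∂μ =
      N.servingFactor k βe *
        expNeg (ENNReal.ofReal (Real.pi * (N.psi A k * βe ^ N.delta) * dist x b ^ 2)) := by
  have hf : ∀ j, Measurable fun y => negLog (N.noiseLaplace A j (N.noiseWeight k βe b j x y)) :=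
    fun j => measurable_negLog.comp ((N.measurable_noiseLaplace A j).comp
      (N.measurable_noiseWeight k βe b j measurable_const measurable_id))
  simp only [HCN.exposure]
  have hmeas : Measurable fun ω => expNeg (∑' p : Fin K × ℕ,
      negLog (N.noiseLaplace A p.1 (N.noiseWeight k βe b p.1 x (V.bs p.1 p.2 ω)))) :=
    measurable_expNeg.comp (Measurable.tsum fun p =>
      (hf p.1).comp ((hV.bs_poisson p.1).measurable p.2))
  rw [lintegral_const_mul _ hmeas]
  congr 1
  simp_rw [ENNReal.tsum_prod']
  have hterm : ∀ j, ENNReal.ofReal (N.bsDensity j) * ∫⁻ y, (1 - expNeg (negLog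
      (N.noiseLaplace A j (N.noiseWeight k βe b j x y)))) =
      ENNReal.ofReal (N.bsDensity j * (Real.pi * βe ^ N.delta * (A j *
        interferenceConst N.pathExp (N.antennas j) *
        (N.xi j * (N.ratio j / N.ratio k) * (N.power j / N.power k)) ^ N.delta) *
          dist x b ^ 2)) := by
    intro j
    simp_rw [fun y => expNeg_negLog (N.noiseLaplace_le_one (hV.activation_nonneg j)
      (hV.activation_le_one j) (N.noiseWeight k βe b j x y))]
    rw [N.lintegral_one_sub_noiseLaplace (hV.activation_nonneg j) (hV.activation_le_one j) k hβ,
      ← ENNReal.ofReal_mul (N.bsDensity_pos j).le]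
  rw [hV.independent.lintegral_expNeg_tsum hV.sourceSigma_le (S := fun j => {.bs j})
    (X := fun j ω => ∑' n, negLog (N.noiseLaplace A j (N.noiseWeight k βe b j x (V.bs j n ω))))
    (fun i j hij => by simpa using hij) ?_
    (fun j => ((hV.bs_poisson j).lintegral_expNeg_tsum (hf j)).trans (congrArg expNeg (hterm j)))]
  · congr 1
    rw [tsum_fintype, ← ENNReal.ofReal_sum_of_nonneg]
    · congr 1
      rw [HCN.psi, Finset.sum_mul, Finset.mul_sum, Finset.sum_mul]
      refine Finset.sum_congr rfl fun j _ => ?_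
      ring
    · intro j _
      have h1 := N.psi_term_nonneg hV.activation_nonneg k j
      have h2 : 0 ≤ Real.pi * βe ^ N.delta * dist x b ^ 2 := by positivity
      calc (0 : ℝ) ≤ _ := mul_nonneg h2 h1
        _ = _ := by ring
  · intro j
    refine measurable_iSup_source (Set.mem_singleton _) ?_
    refine measurable_ennreal_tsum fun n => (hf j).comp ?_
    exact (measurable_pi_apply n).comp (comap_measurable fun ω n => V.bs j n ω)

end NetworkVars

/-! ### Products over a Poisson process in a random environment -/

section RandomEnvironment

variable {Ω α : Type*} [MeasurableSpace Ω] [MeasurableSpace α] {μ : Measure Ω}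
  [IsProbabilityMeasure μ] {Y : Ω → α} {Z : ℕ → Ω → Plane} {lam : ℝ} {G : Plane → α → ℝ≥0∞}

lemma measurable_expNeg_tsum_negLog_one_sub {β : Type*} [MeasurableSpace β]
    (hG : Measurable (Function.uncurry G)) {y : β → α} {z : β → ℕ → Plane} (hy : Measurable y)
    (hz : Measurable z) : Measurable fun p => expNeg (∑' m, negLog (1 - G (z p m) (y p))) := by
  refine measurable_expNeg.comp (Measurable.tsum fun m => measurable_negLog.comp
    (measurable_const.sub ?_))
  have h : Measurable fun p => (z p m, y p) := ((measurable_pi_apply m).comp hz).prodMk hy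
  exact hG.comp h

/-- Averaging over the points first gives the probability generating functional, and Jensen's
inequality then moves the average over the environment into the exponent. -/
lemma IsPoissonProcess.expNeg_le_lintegral (hZ : IsPoissonProcess μ Z lam) (hY : Measurable Y)
    (hI : IndepFun Y (fun ω m => Z m ω) μ) (hG : Measurable (Function.uncurry G))
    (hG1 : ∀ x y, G x y ≤ 1) :
    expNeg (ENNReal.ofReal lam * ∫⁻ x, ∫⁻ ω, G x (Y ω) ∂μ) ≤
      ∫⁻ ω, expNeg (∑' m, negLog (1 - G (Z m ω) (Y ω))) ∂μ := by
  have hGY : Measurable (Function.uncurry fun (ω : Ω) (x : Plane) => G x (Y ω)) :=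
    hG.comp (measurable_snd.prodMk (hY.comp measurable_fst))
  have hJ : Measurable fun ω => ∫⁻ x, G x (Y ω) := hGY.lintegral_prod_right'
  have hpgf : ∀ ω, ∫⁻ ω', expNeg (∑' m, negLog (1 - G (Z m ω') (Y ω))) ∂μ =
      expNeg (ENNReal.ofReal lam * ∫⁻ x, G x (Y ω)) := by
    intro ω
    have hm : Measurable fun x => G x (Y ω) := hG.comp (measurable_id.prodMk measurable_const)
    rw [hZ.lintegral_expNeg_tsum (f := fun x => negLog (1 - G x (Y ω)))
      (measurable_negLog.comp (measurable_const.sub hm))]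
    congr 2
    refine lintegral_congr fun x => ?_
    rw [expNeg_negLog tsub_le_self, ENNReal.sub_sub_cancel ENNReal.one_ne_top (hG1 x _)]
  have hZm : Measurable fun ω m => Z m ω := measurable_pi_lambda _ hZ.measurable
  have hP := hI.lintegral_prodMk hY hZm
    (F := fun y z => expNeg (∑' m, negLog (1 - G (z m) y)))
    (measurable_expNeg_tsum_negLog_one_sub hG measurable_fst measurable_snd)
  rw [hP, lintegral_congr hpgf, ← lintegral_lintegral_swap hGY.aemeasurable,
    ← lintegral_const_mul _ hJ]
  exact expNeg_lintegral_le (hJ.const_mul _)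

lemma one_sub_mul_expNeg {κ : ℝ} (hκ0 : 0 ≤ κ) (hκ1 : κ ≤ 1) (t : ℝ≥0∞) :
    1 - ENNReal.ofReal κ * expNeg t =
      ENNReal.ofReal (1 - κ) + ENNReal.ofReal κ * (1 - expNeg t) := by
  refine ENNReal.sub_eq_of_eq_add (ENNReal.mul_ne_top ENNReal.ofReal_ne_top (expNeg_ne_top t)) ?_
  rw [add_assoc, ← mul_add, tsub_add_cancel_of_le (expNeg_le_one t), mul_one,
    ← ENNReal.ofReal_add (by linarith) hκ0, sub_add_cancel, ENNReal.ofReal_one]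

lemma iInf_one_sub_mul_expNeg (κ : ℝ) (t : ℕ → ℝ≥0∞) :
    ⨅ n, (1 - ENNReal.ofReal κ * expNeg (t n)) = 1 - ENNReal.ofReal κ * expNeg (⨅ n, t n) := by
  have hmono : Monotone fun t => 1 - ENNReal.ofReal κ * expNeg t := fun s t hst =>
    tsub_le_tsub_left (mul_le_mul_right (expNeg_antitone hst) _) 1
  have hcont : Continuous fun t => 1 - ENNReal.ofReal κ * expNeg t :=
    (ENNReal.continuous_sub_left ENNReal.one_ne_top).comp
      ((ENNReal.continuous_const_mul ENNReal.ofReal_ne_top).comp continuous_expNeg)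
  exact (hmono.map_ciInf_of_continuousAt (g := t) hcont.continuousAt).symm

/-- A product over fixed points is bounded, in the mean over the environment, by the mean of each of
its factors. -/
lemma lintegral_expNeg_tsum_le (hY : Measurable Y) (hG : Measurable (Function.uncurry G))
    (hG1 : ∀ x y, G x y ≤ 1) (z : ℕ → Plane) (n : ℕ) :
    ∫⁻ ω, expNeg (∑' m, negLog (1 - G (z m) (Y ω))) ∂μ ≤ 1 - ∫⁻ ω, G (z n) (Y ω) ∂μ := by
  have hm : Measurable fun ω => G (z n) (Y ω) := hG.comp (measurable_const.prodMk hY)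
  have hle : ∫⁻ ω, G (z n) (Y ω) ∂μ ≤ 1 :=
    (lintegral_mono fun ω => hG1 (z n) (Y ω)).trans_eq (by simp)
  have h1 : ∫⁻ ω, (1 - G (z n) (Y ω)) ∂μ = 1 - ∫⁻ ω, G (z n) (Y ω) ∂μ := by
    rw [lintegral_sub hm (ne_top_of_le_ne_top ENNReal.one_ne_top hle)
      (ae_of_all _ fun ω => hG1 (z n) _)]
    simp
  rw [← h1]
  refine lintegral_mono fun ω => ?_
  have h2 : expNeg (∑' m, negLog (1 - G (z m) (Y ω))) ≤ expNeg (negLog (1 - G (z n) (Y ω))) :=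
    expNeg_antitone (ENNReal.le_tsum n)
  rwa [expNeg_negLog tsub_le_self] at h2

/-- If the mean of `G x` over the environment is `κ exp (-c |x - b|²)`, only the point nearest to
`b` is kept: the product is bounded by each of its factors, and the infimum over the points is taken
after averaging over the environment. -/
lemma IsPoissonProcess.lintegral_le_of_lintegral_eq (hZ : IsPoissonProcess μ Z lam)
    (hlam : 0 < lam) (hY : Measurable Y)
    (hI : IndepFun Y (fun ω m => Z m ω) μ) (hG : Measurable (Function.uncurry G))
    (hG1 : ∀ x y, G x y ≤ 1) {κ c : ℝ} (hκ0 : 0 ≤ κ) (hκ1 : κ ≤ 1) (hc : 0 ≤ c) (b : Plane)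
    (hmean : ∀ x, ∫⁻ ω, G x (Y ω) ∂μ =
      ENNReal.ofReal κ * expNeg (ENNReal.ofReal (c * dist x b ^ 2))) :
    ∫⁻ ω, expNeg (∑' m, negLog (1 - G (Z m ω) (Y ω))) ∂μ ≤
      ENNReal.ofReal (1 - κ + κ * (c / (c + lam * Real.pi))) := by
  have hinf : ∀ z : ℕ → Plane, ∫⁻ ω, expNeg (∑' m, negLog (1 - G (z m) (Y ω))) ∂μ ≤
      ENNReal.ofReal (1 - κ) + ENNReal.ofReal κ *
        (1 - expNeg (⨅ n, ENNReal.ofReal (c * dist (z n) b ^ 2))) := by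
    intro z
    rw [← one_sub_mul_expNeg hκ0 hκ1, ← iInf_one_sub_mul_expNeg]
    refine le_iInf fun n => ?_
    rw [← hmean (z n)]
    exact lintegral_expNeg_tsum_le hY hG hG1 z n
  have hpi := Real.pi_pos
  have hZm : Measurable fun ω m => Z m ω := measurable_pi_lambda _ hZ.measurable
  have hfub := hI.symm.lintegral_prodMk hZm hY
    (F := fun z y => expNeg (∑' m, negLog (1 - G (z m) y)))
    (measurable_expNeg_tsum_negLog_one_sub hG measurable_snd measurable_fst)
  have hle : ∫⁻ ω, ∫⁻ ω', expNeg (∑' m, negLog (1 - G (Z m ω) (Y ω'))) ∂μ ∂μ ≤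
      ∫⁻ ω, (ENNReal.ofReal (1 - κ) + ENNReal.ofReal κ *
        (1 - expNeg (⨅ n, ENNReal.ofReal (c * dist (Z n ω) b ^ 2)))) ∂μ :=
    lintegral_mono fun ω => hinf fun m => Z m ω
  have hval : ∫⁻ ω, (ENNReal.ofReal (1 - κ) + ENNReal.ofReal κ *
        (1 - expNeg (⨅ n, ENNReal.ofReal (c * dist (Z n ω) b ^ 2)))) ∂μ =
      ENNReal.ofReal (1 - κ + κ * (c / (c + lam * Real.pi))) := by
    have hpos : 0 ≤ κ * (c / (c + lam * Real.pi)) := by positivity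
    rw [lintegral_add_left measurable_const, lintegral_const, measure_univ, mul_one,
      lintegral_const_mul' _ _ ENNReal.ofReal_ne_top,
      hZ.lintegral_one_sub_expNeg_iInf_sq_dist hlam b hc,
      ← ENNReal.ofReal_mul hκ0, ← ENNReal.ofReal_add (by linarith) hpos]
  exact hfub.trans_le (hle.trans_eq hval)

end RandomEnvironment

/-! ### The bounds on the secrecy probability -/

namespace NetworkVars

variable {K : ℕ} {N : HCN K} {k : Fin K} {Ω : Type*} {V : NetworkVars N k Ω}
  [mΩ : MeasurableSpace Ω] {μ : Measure Ω} {A : Fin K → ℝ} [IsProbabilityMeasure μ]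

lemma measurable_uncurry_exposure (N : HCN K) (A : Fin K → ℝ) (k : Fin K) (βe : ℝ) (b : Plane) :
    Measurable (Function.uncurry (N.exposure A k βe b)) :=
  N.measurable_exposure A k βe b measurable_fst measurable_snd

/-- The mean exposure of a point is `κ exp (-π ψ_k β_e^δ |x - b|²)`, and its integral over the plane
is `κ / (ψ_k β_e^δ)`. -/
lemma IsNetwork.le_secrecyProb (hV : V.IsNetwork μ A) (b : Plane) {βe : ℝ} (hβ : 0 < βe)
    (hψ : 0 < N.psi A k) :
    Real.exp (-(N.eveDensity * (N.psi A k)⁻¹ * βe ^ (-N.delta) *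
      (1 + N.xi k * βe) ^ (1 - (N.antennas k : ℝ)))) ≤ V.secrecyProb μ 0 b βe := by
  have hJ := hV.eve_poisson.expNeg_le_lintegral hV.measurable_bs hV.indepFun_bs_eve
    (measurable_uncurry_exposure N A k βe b) (N.exposure_le_one A k βe b)
  have hξ := N.xi_nonneg k
  have hpi := Real.pi_pos
  have hlam := N.eveDensity_pos
  obtain ⟨c, hc⟩ : ∃ c, c = Real.pi * (N.psi A k * βe ^ N.delta) := ⟨_, rfl⟩
  obtain ⟨κ, hκ⟩ : ∃ κ, κ = (1 + N.xi k * βe) ^ (1 - (N.antennas k : ℝ)) := ⟨_, rfl⟩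
  have hc0 : 0 < c := by rw [hc]; positivity
  have hκ0 : 0 ≤ κ := by rw [hκ]; positivity
  have e : ∀ x, ∫⁻ ω, N.exposure A k βe b x (fun j n => V.bs j n ω) ∂μ =
      ENNReal.ofReal κ * ENNReal.ofReal (Real.exp (-(c * dist x b ^ 2))) := by
    intro x
    rw [hV.lintegral_exposure b x hβ, N.servingFactor_eq k hβ, ← hκ, ← hc,
      expNeg_ofReal (by positivity)]
  have hval : N.eveDensity * (κ * (Real.pi / c)) =
      N.eveDensity * (N.psi A k)⁻¹ * βe ^ (-N.delta) * κ := by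
    have h2 := (Real.rpow_pos_of_pos hβ N.delta).ne'
    rw [hc, Real.rpow_neg hβ.le]
    field_simp
  rw [lintegral_congr e, lintegral_const_mul' _ _ ENNReal.ofReal_ne_top,
    lintegral_exp_neg_mul_sq_dist hc0, ← ENNReal.ofReal_mul hκ0, ← ENNReal.ofReal_mul hlam.le,
    hval, expNeg_ofReal (by positivity)] at hJ
  rw [hV.secrecyProb_eq b hβ, ← hκ]
  refine (ENNReal.ofReal_le_iff_le_toReal (ne_top_of_le_ne_top ENNReal.one_ne_top ?_)).1 hJ
  exact (lintegral_mono fun ω => expNeg_le_one _).trans_eq (by simp)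

/-- Only the eavesdropper nearest to the serving base station is kept. -/
lemma IsNetwork.secrecyProb_le (hV : V.IsNetwork μ A) (b : Plane) {βe : ℝ} (hβ : 0 < βe) :
    V.secrecyProb μ 0 b βe ≤
      1 - N.eveDensity / (N.eveDensity + N.psi A k * βe ^ N.delta) *
        (1 + N.xi k * βe) ^ (1 - (N.antennas k : ℝ)) := by
  have hξ := N.xi_nonneg k
  have hpi := Real.pi_pos
  have hlam := N.eveDensity_pos
  have hψ := N.psi_nonneg hV.activation_nonneg k
  obtain ⟨c, hc⟩ : ∃ c, c = Real.pi * (N.psi A k * βe ^ N.delta) := ⟨_, rfl⟩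
  obtain ⟨κ, hκ⟩ : ∃ κ, κ = (1 + N.xi k * βe) ^ (1 - (N.antennas k : ℝ)) := ⟨_, rfl⟩
  have hc0 : 0 ≤ c := by rw [hc]; positivity
  have hκ0 : 0 ≤ κ := by rw [hκ]; positivity
  have hκE : N.servingFactor k βe = ENNReal.ofReal κ := by rw [N.servingFactor_eq k hβ, hκ]
  have hκ1 : κ ≤ 1 := by
    have := N.servingFactor_le_one k βe
    rwa [hκE, ENNReal.ofReal_le_one] at this
  have hbound := hV.eve_poisson.lintegral_le_of_lintegral_eq hlam hV.measurable_bs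
    hV.indepFun_bs_eve (measurable_uncurry_exposure N A k βe b) (N.exposure_le_one A k βe b)
    hκ0 hκ1 hc0 b (fun x => by rw [hV.lintegral_exposure b x hβ, hκE, hc])
  have hnn : 0 ≤ 1 - κ + κ * (c / (c + N.eveDensity * Real.pi)) :=
    add_nonneg (by linarith) (by positivity)
  rw [hV.secrecyProb_eq b hβ, ← hκ]
  refine (ENNReal.toReal_le_of_le_ofReal hnn hbound).trans (le_of_eq ?_)
  have hden : N.eveDensity + N.psi A k * βe ^ N.delta ≠ 0 := by positivity
  have hden2 : c + N.eveDensity * Real.pi =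
      Real.pi * (N.eveDensity + N.psi A k * βe ^ N.delta) := by
    rw [hc]; ring
  rw [hden2, hc, mul_div_mul_left _ _ hpi.ne']
  field_simp
  ring

end NetworkVars

/-! ### Positivity of the activation probabilities -/

lemma HCN.servingRadius_pos {K : ℕ} (N : HCN K) (j : Fin K) : 0 < N.servingRadius j := by
  have h1 := N.power_pos j
  have h2 : (0 : ℝ) < N.antennas j := by
    have := N.two_le_antennas j
    exact_mod_cast (by omega : 0 < N.antennas j)
  have h3 := N.threshold_pos
  unfold HCN.servingRadius
  positivity

/-- A user within `D_j` of the origin is associated with a tier-`j` base station there, if no base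
station is so near to the origin that it could reach the user. -/
lemma HCN.associated_of_forall_notMem {K : ℕ} (N : HCN K) {x : Fin K → ℕ → Plane} {j : Fin K}
    {u : Plane} (hu : u ∈ Metric.closedBall 0 (N.servingRadius j))
    (hx : ∀ i n, x i n ∉ Metric.closedBall 0 (N.servingRadius i + N.servingRadius j)) :
    N.Associated x j 0 u := by
  have hα : 0 < N.pathExp := two_pos.trans N.two_lt_pathExp
  have hM : (0 : ℝ) < N.antennas j := by
    have := N.two_le_antennas j
    exact_mod_cast (by omega : 0 < N.antennas j)
  rw [Metric.mem_closedBall] at hu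
  have hpos : 0 < N.truncatedARSP j 0 u := by
    rw [HCN.truncatedARSP, if_pos (by rwa [dist_comm])]
    refine ENNReal.mul_pos (by simpa using mul_pos (N.power_pos j) hM) ?_
    unfold pathGain
    intro h0
    rw [ENNReal.rpow_eq_zero_iff] at h0
    rcases h0 with ⟨_, h⟩ | ⟨h, _⟩
    · linarith
    · exact ENNReal.ofReal_ne_top h
  refine ⟨hpos, fun i n => ?_⟩
  rw [HCN.truncatedARSP, if_neg]
  · exact hpos
  · intro hle
    refine hx i n ?_
    have := dist_triangle (x i n) u 0
    rw [Metric.mem_closedBall]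
    linarith

lemma HCN.activationClosedForm_pos {K : ℕ} (N : HCN K) (j : Fin K) :
    0 < N.activationClosedForm j := by
  have hXi : 0 < N.Xi := by
    refine Finset.sum_pos (fun i _ => ?_) ⟨j, Finset.mem_univ j⟩
    have h1 := N.bsDensity_pos i
    have h2 := N.power_pos i
    have h3 : (0 : ℝ) < N.antennas i := by
      have := N.two_le_antennas i
      exact_mod_cast (by omega : 0 < N.antennas i)
    positivity
  have h1 := N.ueDensity_pos
  have h2 := N.power_pos j
  have h3 : (0 : ℝ) < N.antennas j := by
    have := N.two_le_antennas j
    exact_mod_cast (by omega : 0 < N.antennas j)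
  have h4 := N.threshold_pos
  have h5 := Real.pi_pos
  have h6 : 0 < 1 - Real.exp (-(Real.pi * N.threshold ^ (-N.delta) * N.Xi)) := by
    rw [sub_pos, Real.exp_lt_one_iff, neg_lt_zero]
    positivity
  rw [activationClosedForm, sub_pos, Real.exp_lt_one_iff, neg_lt_zero]
  positivity

namespace NetworkVars

variable {K : ℕ} {N : HCN K} {k : Fin K} {Ω : Type*} {V : NetworkVars N k Ω}
  [mΩ : MeasurableSpace Ω] {μ : Measure Ω} {A : Fin K → ℝ} [IsProbabilityMeasure μ]

lemma IsNetwork.measure_forall_bs_notMem_pos (hV : V.IsNetwork μ A) {B : Fin K → Set Plane}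
    (hB : ∀ i, MeasurableSet (B i)) (hfin : ∀ i, volume (B i) ≠ ⊤) :
    0 < μ {ω | ∀ i n, V.bs i n ω ∉ B i} := by
  have hi : iIndep (fun i => V.sourceSigma (.bs i)) μ :=
    hV.independent.precomp (g := Source.bs) (fun i j h => by simpa using h)
  have hE : ∀ i, MeasurableSet[V.sourceSigma (.bs i)] {ω | ∀ n, V.bs i n ω ∉ B i} := by
    intro i
    have hS : MeasurableSet {x : ℕ → Plane | ∀ n, x n ∉ B i} := by
      simp only [Set.ofPred_forall]
      refine MeasurableSet.iInter fun n => ?_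
      have : Measurable fun x : ℕ → Plane => x n := measurable_pi_apply n
      exact this (hB i).compl
    exact ⟨_, hS, rfl⟩
  have heq : {ω | ∀ i n, V.bs i n ω ∉ B i} = ⋂ i, {ω | ∀ n, V.bs i n ω ∉ B i} := by
    ext ω
    simp
  rw [heq, hi.meas_iInter hE]
  refine CanonicallyOrderedAdd.prod_pos.2 fun i _ => ?_
  rw [(hV.bs_poisson i).measure_forall_notMem (hB i), expNeg_eq_of_ne_top
    (ENNReal.mul_ne_top ENNReal.ofReal_ne_top (hfin i))]
  simpa using Real.exp_pos _

lemma _root_.IsPoissonProcess.measure_exists_mem_pos {X : ℕ → Ω → Plane} {lam : ℝ}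
    (hX : IsPoissonProcess μ X lam) (hlam : 0 < lam) {C : Set Plane} (hC : MeasurableSet C)
    (h0 : volume C ≠ 0) (hfin : volume C ≠ ⊤) : 0 < μ {ω | ∃ m, X m ω ∈ C} := by
  have hvoid := hX.measure_forall_notMem hC
  have hm : MeasurableSet {ω | ∃ m, X m ω ∈ C} := by
    simp only [Set.ofPred_exists]
    exact MeasurableSet.iUnion fun m => hX.measurable m hC
  have hc : {ω | ∃ m, X m ω ∈ C}ᶜ = {ω | ∀ n, X n ω ∉ C} := by
    ext ω
    simp
  rw [← hc, prob_compl_eq_one_sub hm] at hvoid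
  by_contra hn
  rw [not_lt, nonpos_iff_eq_zero] at hn
  rw [hn, tsub_zero] at hvoid
  have hvol : 0 < ENNReal.ofReal lam * volume C := ENNReal.mul_pos (by simpa using hlam) h0
  have hvf : ENNReal.ofReal lam * volume C ≠ ⊤ := ENNReal.mul_ne_top ENNReal.ofReal_ne_top hfin
  rw [expNeg_eq_of_ne_top hvf, eq_comm, ENNReal.ofReal_eq_one, Real.exp_eq_one_iff,
    neg_eq_zero] at hvoid
  exact (ENNReal.toReal_pos hvol.ne' hvf).ne' hvoid

/-- The typical base station of tier `j` serves a user with positive probability: there may be no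
other base station within the sum of its own serving radius and `D_j`, and then every user within
distance `D_j` is associated with the typical one. -/
lemma IsNetwork.activationProb_pos (hV : V.IsNetwork μ A) (j : Fin K) :
    0 < N.activationProb μ V.bs V.ue j := by
  have hB : ∀ i, MeasurableSet
      (Metric.closedBall (0 : Plane) (N.servingRadius i + N.servingRadius j)) :=
    fun i => measurableSet_closedBall
  have hE0 := hV.measure_forall_bs_notMem_pos hB fun i => measure_closedBall_lt_top.ne
  have hF0 := hV.ue_poisson.measure_exists_mem_pos N.ueDensity_pos
    (measurableSet_closedBall (x := (0 : Plane)) (ε := N.servingRadius j))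
    (Metric.measure_closedBall_pos _ _ (N.servingRadius_pos j)).ne' measure_closedBall_lt_top.ne
  have hS : MeasurableSet {x : Fin K → ℕ → Plane |
      ∀ i n, x i n ∉ Metric.closedBall 0 (N.servingRadius i + N.servingRadius j)} := by
    simp only [Set.ofPred_forall]
    refine MeasurableSet.iInter fun i => MeasurableSet.iInter fun n => ?_
    have : Measurable fun x : Fin K → ℕ → Plane => x i n :=
      (measurable_pi_apply n).comp (measurable_pi_apply i)
    exact this (hB i).compl
  have hT : MeasurableSet {u : ℕ → Plane |
      ∃ m, u m ∈ Metric.closedBall 0 (N.servingRadius j)} := by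
    simp only [Set.ofPred_exists]
    refine MeasurableSet.iUnion fun m => ?_
    have : Measurable fun u : ℕ → Plane => u m := measurable_pi_apply m
    exact this measurableSet_closedBall
  have hind := hV.indepFun_bs_ue.measure_inter_preimage_eq_mul _ _ hS hT
  have h1 : 0 < μ {ω | ∃ m, N.Associated (fun i n => V.bs i n ω) j 0 (V.ue m ω)} := by
    refine (ENNReal.mul_pos hE0.ne' hF0.ne').trans_le (hind.symm.trans_le (measure_mono ?_))
    rintro ω ⟨hE, m, hm⟩
    exact ⟨m, N.associated_of_forall_notMem hm hE⟩
  exact ENNReal.toReal_pos h1.ne' (measure_ne_top _ _)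

end NetworkVars

theorem corollary3 {K : ℕ} (N : HCN K) (k : Fin K)
    {Ω : Type*} [MeasurableSpace Ω] (μ : Measure Ω) [IsProbabilityMeasure μ]
    (V : NetworkVars N k Ω) (A : Fin K → ℝ)
    (hA : (∀ j, A j = N.activationProb μ V.bs V.ue j) ∨ (∀ j, A j = N.activationClosedForm j))
    (hV : V.IsNetwork μ A) (b : Plane) (βe : ℝ) (hβ : 0 < βe) :
    ((∃ j, N.ratio j < 1) →
      Real.exp (-(N.eveDensity * (N.psi A k)⁻¹ * βe ^ (-N.delta) *
        (1 + N.xi k * βe) ^ (1 - (N.antennas k : ℝ)))) ≤ V.secrecyProb μ 0 b βe) ∧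
    V.secrecyProb μ 0 b βe ≤
      1 - N.eveDensity / (N.eveDensity + N.psi A k * βe ^ N.delta) *
        (1 + N.xi k * βe) ^ (1 - (N.antennas k : ℝ)) := by
  refine ⟨fun h => ?_, hV.secrecyProb_le b hβ⟩
  have hApos : ∀ j, 0 < A j := by
    intro j
    rcases hA with hA | hA
    · rw [hA j]
      exact hV.activationProb_pos j
    · rw [hA j]
      exact N.activationClosedForm_pos j
  exact hV.le_secrecyProb b hβ (N.psi_pos hApos k h)
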